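/- Let $n>1$ be an integer, $\langle z,w\rangle=\sum_{j=1}^n z_j\overline{w_j}$ and $|z|=\sqrt{\langle z,z\rangle}$ on $\mathbb{C}^n$, $B=\{z\in\mathbb{C}^n:|z|<1\}$, $S=\{z\in\mathbb{C}^n:|z|=1\}$, and let $\sigma$ be the Lebesgue measure on $S$ normalized so that $\sigma(S)=1$. For $w\in B$ let $\varphi_w$ be the involutive automorphism of $B$ $$\varphi_w(z)=\frac{w-P_wz-(1-|w|^2)^{1/2}(z-P_wz)}{1-\langle z,w\rangle},\qquad P_wz=\frac{\langle z,w\rangle}{|w|^2}w\ (w\neq 0),\quad P_0z=0,$$ and let $G(z,w)=g(\varphi_w(z))$, where $$g(z)=\frac{n+1}{2n}\int_{|z|}^1(1-t^2)^{n-1}t^{-2n+1}\,dt$$ (so $g(0)=+\infty$), be the Green's function of the invariant Laplacian on $B$. Let $1<p<\frac{2n-1}{2(n-1)}$, $0\le\gamma<2n$, and let $\mu$ be a nonnegative Borel measure on $B$ with $$\int_B(1-|w|^2)^n\,d\mu(w)<\infty.$$ Put $G_\mu(z)=\int_B G(z,w)\,d\mu(w)$, $d\lambda(w)=(1-|w|)^n\,d\mu(w)$,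 $$m_p(r,G_\mu)=\left(\int_S|G_\mu(r\xi)|^p\,d\sigma(\xi)\right)^{1/p},$$ and, for $\xi\in S$ and $\delta>0$, $C(\xi,\delta)=\{z\in B:|1-\langle z,\xi\rangle|^{1/2}<\delta^{1/2}\}$. Then $$m_p(r,G_\mu)=o\left((1-r)^{\gamma-n}\right),\qquad r\to 1-,$$ if and only if $$\left(\int_S\lambda^p(C(\xi,\delta))\,d\sigma(\xi)\right)^{1/p}=o(\delta^\gamma),\qquad \delta\to 0+,$$ where $\lambda^p(C(\xi,\delta))$ denotes $(\lambda(C(\xi,\delta)))^p$. -/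

import Mathlib

open MeasureTheory Filter Topology
open scoped ENNReal

noncomputable section

namespace GreenPotential

/-- The space `ℂⁿ` with its Euclidean norm. -/
abbrev Cn (n : ℕ) : Type := EuclideanSpace ℂ (Fin n)

/-- The open unit ball `B` of `ℂⁿ`. -/
abbrev B (n : ℕ) : Set (Cn n) := Metric.ball (0 : Cn n) 1

/-- The unit sphere `S` of `ℂⁿ`. -/
abbrev S (n : ℕ) : Set (Cn n) := Metric.sphere (0 : Cn n) 1

/-- The Hermitian product `⟨z, w⟩ = ∑ j, z_j * conj w_j`, linear in the first variable. -/
def herm {n : ℕ} (z w : Cn n) : ℂ := ∑ j, z j * (starRingEnd ℂ) (w j)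

/-- The orthogonal projection `P_w` onto the line spanned by `w`, with `P_0 = 0`. -/
def proj {n : ℕ} (w z : Cn n) : Cn n := (herm z w / ((‖w‖ ^ 2 : ℝ) : ℂ)) • w

/-- The involutive automorphism `φ_w` of the unit ball (meaningful for `w`, `z` in the ball). -/
def phi {n : ℕ} (w z : Cn n) : Cn n :=
  (1 - herm z w)⁻¹ •
    (w - proj w z - ((Real.sqrt (1 - ‖w‖ ^ 2) : ℝ) : ℂ) • (z - proj w z))

/-- The radial function `g(z) = (n+1)/(2n) ∫_{|z|}^1 (1-t²)^(n-1) t^(-2n+1) dt`, with values in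
`[0, ∞]`; in particular `g 0 = ∞`. -/
def g {n : ℕ} (z : Cn n) : ℝ≥0∞ :=
  ENNReal.ofReal (((n : ℝ) + 1) / (2 * n)) *
    ∫⁻ t in Set.Ioo ‖z‖ 1,
      ENNReal.ofReal ((1 - t ^ 2) ^ ((n : ℤ) - 1) * t ^ (-2 * (n : ℤ) + 1))

/-- The Green function `G(z, w) = g(φ_w(z))` of the invariant Laplacian. -/
def green {n : ℕ} (z w : Cn n) : ℝ≥0∞ := g (phi w z)

/-- The invariant Green potential `G_μ` of a Borel measure `μ` on the ball, with values in
`[0, ∞]`. -/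
def potential {n : ℕ} (μ : Measure (B n)) (z : Cn n) : ℝ≥0∞ :=
  ∫⁻ w : B n, green z (w : Cn n) ∂μ

/-- The Lebesgue (surface) measure on the unit sphere, normalized to total mass one. -/
def sigma (n : ℕ) : Measure (S n) :=
  ((volume : Measure (Cn n)).toSphere Set.univ)⁻¹ • (volume : Measure (Cn n)).toSphere

/-- The `p`-th integral mean `m_p(r, u)` of a nonnegative function `u`. -/
def mean {n : ℕ} (p r : ℝ) (u : Cn n → ℝ≥0∞) : ℝ≥0∞ :=
  (∫⁻ ξ : S n, u (r • (ξ : Cn n)) ^ p ∂(sigma n)) ^ (1 / p)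

/-- The anisotropic metric `d(a, b) = |1 - ⟨a, b⟩|^(1/2)`. -/
def aniso {n : ℕ} (a b : Cn n) : ℝ := Real.sqrt ‖1 - herm a b‖

/-- The set `C(ξ, δ) = {z ∈ B : d(z, ξ) < δ^(1/2)}`. -/
def C {n : ℕ} (ξ : S n) (δ : ℝ) : Set (B n) :=
  {z | aniso (z : Cn n) (ξ : Cn n) < Real.sqrt δ}

/-- The measure `dλ(w) = (1 - |w|)^n dμ(w)` on the ball. -/
def lam {n : ℕ} (μ : Measure (B n)) : Measure (B n) :=
  μ.withDensity fun w => ENNReal.ofReal ((1 - ‖(w : Cn n)‖) ^ n)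

end GreenPotential

end

noncomputable section

namespace GreenPotential

/-! ### Hermitian algebra: the modulus of `phi` and the quasi-metric |1 - ⟨a, b⟩|. -/

section Hermitian

variable {n : ℕ}

/-! Write δ = 1 - r. Both implications come from comparing G_μ(rξ) with δ^(-n) λ(C(ξ, δ)), using 1 -
|φ_w(z)|² = (1 - |w|²)(1 - |z|²)/|1 - ⟨z, w⟩|².

For the forward implication, g(z) ≥ c(1 - |z|²)^n, and |1 - ⟨rξ, w⟩| < 2δ for w in C(ξ, δ). Hence
G_μ(rξ) ≥ c δ^(-n) λ(C(ξ, δ)) pointwise (`exists_le_potential`), and it remains to take p-means.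

For the converse, g is at most a constant times (1 - |z|²)^n plus a dyadic sum of 2^(j(2n-2)) over
those j with |z| < 2^(-j-1), which models the pole (`exists_g_le`). The first term is handled by
dyadic shells around ξ and yields δ^(-n) Σ_k 4^(-nk) λ(C(ξ, 2^k δ)). The second yields δ^(-n) Σ_j
2^(j(2n-2)) λ(`near` (rξ) 2^(-j-1)), because 1 - |w| is comparable to δ on these sets
(`exists_potential_le`).

The main estimate is `exists_lintegral_near_rpow_le`: shrinking the set by a factor s gains s^(2n-1)
in the p-th power integral. The gain comes from the real dimension 2n - 1 of the sphere: those ξ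
with |φ_w(rξ)| < s lie in a set of size sδ in one real direction and s√δ in 2n - 2 others. By
Minkowski the pole part is then controlled by Σ_j 2^(j(2n-2)) 2^(-j(2n-1)/p), which converges since
p < (2n-1)/(2n-2).

The hypothesis γ < 2n makes the shell sum harmless: the means of λ(C(ξ, t)) are bounded and o(t^γ),
and Σ_k 4^(-nk) 2^(kγ') converges for γ < γ' < 2n (`tendsto_dyadic_sum_div`). -/

theorem herm_eq_inner (z w : Cn n) : herm z w = inner ℂ w z := by
  simp [herm, PiLp.inner_apply]

theorem conj_herm (z w : Cn n) : (starRingEnd ℂ) (herm z w) = herm w z := by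
  simp [herm_eq_inner]

theorem herm_self (z : Cn n) : herm z z = ((‖z‖ ^ 2 : ℝ) : ℂ) := by
  rw [herm_eq_inner, inner_self_eq_norm_sq_to_K]
  norm_cast

theorem herm_sub_left (a b c : Cn n) : herm (a - b) c = herm a c - herm b c := by
  simp [herm_eq_inner]

theorem herm_sub_right (a b c : Cn n) : herm a (b - c) = herm a b - herm a c := by
  simp [herm_eq_inner]

theorem herm_smul_left (t : ℂ) (a b : Cn n) : herm (t • a) b = t * herm a b := by
  simp [herm_eq_inner]

theorem herm_smul_right (t : ℂ) (a b : Cn n) :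
    herm a (t • b) = (starRingEnd ℂ) t * herm a b := by
  simp [herm_eq_inner, mul_comm]

theorem real_smul_eq (t : ℝ) (a : Cn n) : t • a = (t : ℂ) • a := by
  ext i; simp

theorem herm_zero_right (a : Cn n) : herm a 0 = 0 := by simp [herm]

theorem norm_herm_le (z w : Cn n) : ‖herm z w‖ ≤ ‖z‖ * ‖w‖ := by
  rw [herm_eq_inner, mul_comm]
  exact norm_inner_le_norm w z

theorem norm_one_sub_herm_comm (z w : Cn n) : ‖1 - herm z w‖ = ‖1 - herm w z‖ := by
  rw [← conj_herm w z, ← RCLike.norm_conj (1 - herm w z)]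
  simp

theorem one_sub_norm_mul_le (z w : Cn n) : 1 - ‖z‖ * ‖w‖ ≤ ‖1 - herm z w‖ := by
  have h1 := norm_herm_le z w
  have h2 := norm_sub_norm_le (1 : ℂ) (herm z w)
  simp only [norm_one] at h2
  linarith

theorem one_sub_norm_le_left {z w : Cn n} (hw : ‖w‖ ≤ 1) : 1 - ‖z‖ ≤ ‖1 - herm z w‖ := by
  have := one_sub_norm_mul_le z w
  nlinarith [norm_nonneg z]

theorem one_sub_norm_le_right {z w : Cn n} (hz : ‖z‖ ≤ 1) : 1 - ‖w‖ ≤ ‖1 - herm z w‖ := by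
  rw [norm_one_sub_herm_comm]
  exact one_sub_norm_le_left hz

theorem norm_one_sub_herm_le_add (a b c : Cn n) :
    ‖1 - herm a c‖ ≤ ‖1 - herm b c‖ + ‖a - b‖ * ‖c‖ := by
  have h : 1 - herm a c = (1 - herm b c) - herm (a - b) c := by
    rw [herm_sub_left]; ring
  rw [h]
  exact (norm_sub_le _ _).trans (by gcongr; exact norm_herm_le _ _)

theorem norm_sub_proj_sq (z ζ : Cn n) (hζ : ‖ζ‖ = 1) :
    ‖z - herm z ζ • ζ‖ ^ 2 = ‖z‖ ^ 2 - ‖herm z ζ‖ ^ 2 := by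
  have h : ((‖z - herm z ζ • ζ‖ ^ 2 : ℝ) : ℂ) = ((‖z‖ ^ 2 - ‖herm z ζ‖ ^ 2 : ℝ) : ℂ) := by
    rw [← herm_self]
    simp only [herm_sub_left, herm_sub_right, herm_smul_left, herm_smul_right, conj_herm]
    simp only [herm_self, hζ]
    have h2 : herm z ζ * herm ζ z = ((‖herm z ζ‖ ^ 2 : ℝ) : ℂ) := by
      rw [← conj_herm z ζ, Complex.mul_conj, Complex.normSq_eq_norm_sq]
    push_cast at h2 ⊢
    linear_combination (-1 : ℂ) * h2
  exact_mod_cast h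

/-- The expansion behind `1 - |φ_w(z)|² = (1 - |w|²)(1 - |z|²) / |1 - ⟨z, w⟩|²`, in terms of
`w = t ζ` with `ζ` a unit vector. -/
theorem norm_one_sub_herm_sq_sub (z ζ : Cn n) (hζ : ‖ζ‖ = 1) (t : ℝ) :
    ‖1 - herm z ((t : ℂ) • ζ)‖ ^ 2 - (1 - t ^ 2) * (1 - ‖z‖ ^ 2) =
      ‖(t : ℂ) - herm z ζ‖ ^ 2 + (1 - t ^ 2) * ‖z - herm z ζ • ζ‖ ^ 2 := by
  rw [norm_sub_proj_sq z ζ hζ, herm_smul_right, Complex.conj_ofReal]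
  simp only [← Complex.normSq_eq_norm_sq, Complex.normSq_apply]
  simp
  ring

/-- Pythagoras: the numerator of φ_w splits into a multiple of ζ and a vector orthogonal to ζ. -/
theorem norm_phi_numerator_sq (z ζ : Cn n) (hζ : ‖ζ‖ = 1) (t s : ℝ) :
    ‖(t : ℂ) • ζ - herm z ζ • ζ - (s : ℂ) • (z - herm z ζ • ζ)‖ ^ 2 =
      ‖(t : ℂ) - herm z ζ‖ ^ 2 + s ^ 2 * ‖z - herm z ζ • ζ‖ ^ 2 := by
  have h0 : herm (z - herm z ζ • ζ) ζ = 0 := by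
    rw [herm_sub_left, herm_smul_left, herm_self, hζ]; simp
  have h1 : herm ζ (z - herm z ζ • ζ) = 0 := by
    rw [← conj_herm, h0, map_zero]
  rw [← sub_smul]
  generalize z - herm z ζ • ζ = v at h0 h1 ⊢
  generalize (t : ℂ) - herm z ζ = c
  have h : ((‖c • ζ - (s : ℂ) • v‖ ^ 2 : ℝ) : ℂ) = ((‖c‖ ^ 2 + s ^ 2 * ‖v‖ ^ 2 : ℝ) : ℂ) := by
    rw [← herm_self]
    simp only [herm_sub_left, herm_sub_right, herm_smul_left, herm_smul_right, h0, h1,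
      Complex.conj_ofReal]
    simp only [herm_self, hζ]
    have h2 : c * (starRingEnd ℂ) c = ((‖c‖ ^ 2 : ℝ) : ℂ) := by
      rw [Complex.mul_conj, Complex.normSq_eq_norm_sq]
    push_cast at h2 ⊢
    linear_combination h2
  exact_mod_cast h

theorem exists_unit_smul (w : Cn n) (hw : w ≠ 0) :
    ∃ ζ : Cn n, ‖ζ‖ = 1 ∧ w = ((‖w‖ : ℝ) : ℂ) • ζ := by
  have h : ‖w‖ ≠ 0 := norm_ne_zero_iff.2 hw
  refine ⟨((‖w‖⁻¹ : ℝ) : ℂ) • w, ?_, ?_⟩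
  · rw [norm_smul]; simp [h]
  · rw [smul_smul, ← Complex.ofReal_mul, mul_inv_cancel₀ h]; simp

/-- With s² = 1 - |w|² and t = |w|, the right-hand sides of `norm_phi_numerator_sq` and
`norm_one_sub_herm_sq_sub` coincide. -/
theorem norm_phi_sq_mul {z w : Cn n} (hz : ‖z‖ < 1) (hw : ‖w‖ < 1) :
    ‖phi w z‖ ^ 2 * ‖1 - herm z w‖ ^ 2 =
      ‖1 - herm z w‖ ^ 2 - (1 - ‖w‖ ^ 2) * (1 - ‖z‖ ^ 2) := by
  have hpos : 0 < ‖1 - herm z w‖ := lt_of_lt_of_le (by linarith) (one_sub_norm_le_left hw.le)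
  rw [phi, norm_smul, norm_inv, mul_pow, inv_pow, mul_comm, ← mul_assoc,
    mul_inv_cancel₀ (by positivity), one_mul]
  by_cases h0 : w = 0
  · subst h0
    simp [proj, herm_zero_right]
  obtain ⟨ζ, hζ, hwζ⟩ := exists_unit_smul w h0
  have ht : (‖w‖ : ℂ) ≠ 0 := by exact_mod_cast norm_ne_zero_iff.2 h0
  have hproj : proj w z = herm z ζ • ζ := by
    rw [proj]
    have h1 : herm z w = (‖w‖ : ℂ) * herm z ζ := by
      conv_lhs => rw [hwζ]
      rw [herm_smul_right, Complex.conj_ofReal]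
    rw [h1]
    conv_lhs => rw [hwζ]
    rw [norm_smul, hζ, smul_smul]
    congr 1
    simp
    field_simp
  rw [hproj]
  have h2 := norm_phi_numerator_sq z ζ hζ ‖w‖ (Real.sqrt (1 - ‖w‖ ^ 2))
  have h3 := norm_one_sub_herm_sq_sub z ζ hζ ‖w‖
  rw [← hwζ] at h2 h3
  rw [h2, h3, Real.sq_sqrt (by nlinarith [norm_nonneg w])]

theorem norm_phi_lt_one {z w : Cn n} (hz : ‖z‖ < 1) (hw : ‖w‖ < 1) : ‖phi w z‖ < 1 := by
  have hpos : 0 < ‖1 - herm z w‖ := lt_of_lt_of_le (by linarith) (one_sub_norm_le_left hw.le)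
  have h := norm_phi_sq_mul hz hw
  have h1 : 0 < (1 - ‖w‖ ^ 2) * (1 - ‖z‖ ^ 2) := by
    apply mul_pos <;> nlinarith [norm_nonneg w, norm_nonneg z]
  by_contra! hc
  nlinarith [mul_le_mul_of_nonneg_right (one_le_pow₀ hc (n := 2)) (sq_nonneg ‖1 - herm z w‖)]

theorem one_sub_norm_phi_sq {z w : Cn n} (hz : ‖z‖ < 1) (hw : ‖w‖ < 1) :
    1 - ‖phi w z‖ ^ 2 = (1 - ‖w‖ ^ 2) * (1 - ‖z‖ ^ 2) / ‖1 - herm z w‖ ^ 2 := by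
  have hpos : 0 < ‖1 - herm z w‖ := lt_of_lt_of_le (by linarith) (one_sub_norm_le_left hw.le)
  have h := norm_phi_sq_mul hz hw
  rw [eq_div_iff (by positivity)]
  linarith

/-- The quasi-triangle inequality with intermediate point on the sphere. -/
theorem norm_one_sub_herm_le_of_unit {v w ζ : Cn n} (hv : ‖v‖ ≤ 1) (hw : ‖w‖ ≤ 1)
    (hζ : ‖ζ‖ = 1) :
    ‖1 - herm v w‖ ≤ 2 * (‖1 - herm v ζ‖ + ‖1 - herm w ζ‖) := by
  -- The part of u orthogonal to ζ has size at most a constant times the square root of |1 - ⟨u,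
  -- ζ⟩|, so the product of two such parts is again of first order.
  have hbound : ∀ u : Cn n, ‖u‖ ≤ 1 → ‖u - herm u ζ • ζ‖ ^ 2 ≤ 2 * ‖1 - herm u ζ‖ := by
    intro u hu
    rw [norm_sub_proj_sq u ζ hζ]
    have h1 : ‖herm u ζ‖ ≤ 1 := (norm_herm_le u ζ).trans (by rw [hζ]; linarith)
    have h2 := norm_sub_norm_le (1 : ℂ) (herm u ζ)
    simp only [norm_one] at h2
    nlinarith [norm_nonneg u, norm_nonneg (herm u ζ)]
  have hv' := hbound v hv
  have hw' := hbound w hw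
  have e : herm v w = herm v ζ * (starRingEnd ℂ) (herm w ζ) +
      herm (v - herm v ζ • ζ) (w - herm w ζ • ζ) := by
    simp only [herm_sub_left, herm_sub_right, herm_smul_left, herm_smul_right, herm_self, hζ,
      conj_herm]
    push_cast
    ring
  have e2 : 1 - herm v w = (1 - herm v ζ) + herm v ζ * (starRingEnd ℂ) (1 - herm w ζ) -
      herm (v - herm v ζ • ζ) (w - herm w ζ • ζ) := by
    rw [e, map_sub, map_one]; ring
  have h1 : ‖herm v ζ‖ ≤ 1 := (norm_herm_le v ζ).trans (by rw [hζ]; linarith)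
  have h3 := norm_herm_le (v - herm v ζ • ζ) (w - herm w ζ • ζ)
  have h4 : ‖1 - herm v w‖ ≤ ‖1 - herm v ζ‖ + ‖herm v ζ‖ * ‖1 - herm w ζ‖ +
      ‖herm (v - herm v ζ • ζ) (w - herm w ζ • ζ)‖ := by
    rw [e2]
    refine (norm_sub_le _ _).trans ?_
    gcongr
    refine (norm_add_le _ _).trans ?_
    rw [norm_mul, RCLike.norm_conj]
  nlinarith [two_mul_le_add_sq ‖v - herm v ζ • ζ‖ ‖w - herm w ζ • ζ‖,
    mul_le_mul_of_nonneg_right h1 (norm_nonneg (1 - herm w ζ))]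

/-- The quasi-triangle inequality on the closed ball. -/
theorem norm_one_sub_herm_le {v w c : Cn n} (hv : ‖v‖ ≤ 1) (hw : ‖w‖ ≤ 1) (hc : ‖c‖ ≤ 1) :
    ‖1 - herm v w‖ ≤ 4 * (‖1 - herm v c‖ + ‖1 - herm w c‖) := by
  by_cases h0 : c = 0
  · subst h0
    simp only [herm_zero_right, sub_zero, norm_one]
    have h1 := norm_herm_le v w
    have h2 := norm_sub_le (1 : ℂ) (herm v w)
    simp only [norm_one] at h2
    nlinarith [norm_nonneg v, norm_nonneg w]
  obtain ⟨ζ, hζ, hcζ⟩ := exists_unit_smul c h0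
  -- The centre c may be pushed radially to the sphere: it moves by 1 - |c|, which is itself at most
  -- |1 - ⟨u, c⟩|.
  have hbound : ∀ u : Cn n, ‖u‖ ≤ 1 → ‖1 - herm u ζ‖ ≤ 2 * ‖1 - herm u c‖ := by
    intro u hu
    have h1 := norm_one_sub_herm_le_add ζ c u
    have h2 : ‖ζ - c‖ = 1 - ‖c‖ := by
      have : ζ - c = ((1 - ‖c‖ : ℝ) : ℂ) • ζ := by
        conv_lhs => rw [hcζ]
        push_cast
        rw [sub_smul, one_smul]
      rw [this, norm_smul, hζ, mul_one, Complex.norm_real, Real.norm_of_nonneg (by linarith)]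
    rw [norm_one_sub_herm_comm ζ u, norm_one_sub_herm_comm c u, h2] at h1
    have h3 := one_sub_norm_le_right (z := u) (w := c) hu
    nlinarith [norm_nonneg u]
  have := norm_one_sub_herm_le_of_unit hv hw hζ
  linarith [hbound v hv, hbound w hw]

end Hermitian

/-! ### Two-sided bounds for the radial function `g`. -/

section RadialBounds

variable {n : ℕ}

theorem green_density_eq (hn : 1 < n) (t : ℝ) :
    (1 - t ^ 2) ^ ((n : ℤ) - 1) * t ^ (-2 * (n : ℤ) + 1) =
      (1 - t ^ 2) ^ (n - 1) * (t ^ (2 * n - 1))⁻¹ := by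
  have h1 : (n : ℤ) - 1 = ((n - 1 : ℕ) : ℤ) := by omega
  have h2 : -2 * (n : ℤ) + 1 = -((2 * n - 1 : ℕ) : ℤ) := by omega
  rw [h1, h2, zpow_natCast, zpow_neg, zpow_natCast]

/-- Integrating only over the left half of (|z|, 1) suffices: there 1 - t² ≥ (1 - |z|)/2, the weight
t^(-2n+1) is at least 1, and (1 - |z|)/2 ≥ (1 - |z|²)/4. -/
theorem exists_le_g (hn : 1 < n) :
    ∃ c : ℝ, 0 < c ∧ ∀ z : Cn n, ‖z‖ < 1 → ENNReal.ofReal (c * (1 - ‖z‖ ^ 2) ^ n) ≤ g z := by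
  have hn0 : (0 : ℝ) < n := by exact_mod_cast (by omega : 0 < n)
  refine ⟨((n : ℝ) + 1) / (2 * n) * (1 / 4) ^ n, by positivity, fun z hz => ?_⟩
  have hz0 := norm_nonneg z
  rw [g, mul_assoc, ENNReal.ofReal_mul (by positivity)]
  gcongr
  calc ENNReal.ofReal ((1 / 4) ^ n * (1 - ‖z‖ ^ 2) ^ n)
      ≤ ENNReal.ofReal (((1 - ‖z‖) / 2) ^ (n - 1)) * volume (Set.Ioo ‖z‖ ((1 + ‖z‖) / 2)) := by
        rw [Real.volume_Ioo, ← ENNReal.ofReal_mul (by apply pow_nonneg; linarith)]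
        apply ENNReal.ofReal_le_ofReal
        have e : (1 + ‖z‖) / 2 - ‖z‖ = (1 - ‖z‖) / 2 := by ring
        rw [e, ← pow_succ, Nat.sub_add_cancel hn.le, ← mul_pow]
        apply pow_le_pow_left₀ <;> nlinarith
    _ = ∫⁻ _ in Set.Ioo ‖z‖ ((1 + ‖z‖) / 2), ENNReal.ofReal (((1 - ‖z‖) / 2) ^ (n - 1)) := by
        rw [setLIntegral_const]
    _ ≤ ∫⁻ t in Set.Ioo ‖z‖ ((1 + ‖z‖) / 2),
          ENNReal.ofReal ((1 - t ^ 2) ^ ((n : ℤ) - 1) * t ^ (-2 * (n : ℤ) + 1)) := by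
        refine setLIntegral_mono' measurableSet_Ioo fun t ht => ENNReal.ofReal_le_ofReal ?_
        obtain ⟨h1, h2⟩ := ht
        have ht0 : 0 < t := by linarith
        rw [green_density_eq hn]
        calc ((1 - ‖z‖) / 2) ^ (n - 1) ≤ (1 - t ^ 2) ^ (n - 1) := by
              apply pow_le_pow_left₀ <;> nlinarith
          _ ≤ _ := by
              apply le_mul_of_one_le_right (pow_nonneg (by nlinarith) _)
              exact (one_le_inv₀ (by positivity)).2 (pow_le_one₀ ht0.le (by linarith))
    _ ≤ _ := lintegral_mono_set (Set.Ioo_subset_Ioo_right (by linarith))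

/-- Away from 0 the integrand is O((1 - |z|²)^(n-1)). Near 0 the shell [2^(-j-2), 2^(-j-1))
contributes at most 2^((j+2)(2n-2)), and only if it meets (|z|, 1). The pole of order 2n - 2 thus
becomes a sum over sublevel sets of |z|, which integrates to measures of `near` sets. -/
theorem exists_g_le (hn : 1 < n) :
    ∃ K : ℝ, 0 < K ∧ ∀ z : Cn n, ‖z‖ < 1 →
      g z ≤ ENNReal.ofReal K * (ENNReal.ofReal ((1 - ‖z‖ ^ 2) ^ n) +
        ∑' j : ℕ, if ‖z‖ < (1 / 2) ^ (j + 1) then ENNReal.ofReal (2 ^ (j * (2 * n - 2))) else 0) := by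
  have hn0 : (0 : ℝ) < n := by exact_mod_cast (by omega : 0 < n)
  refine ⟨((n : ℝ) + 1) / (2 * n) * 2 ^ (4 * n), by positivity, fun z hz => ?_⟩
  have hz0 := norm_nonneg z
  rw [g, ENNReal.ofReal_mul (by positivity), mul_assoc]
  gcongr
  set f : ℝ → ℝ≥0∞ := fun t =>
    ENNReal.ofReal ((1 - t ^ 2) ^ ((n : ℤ) - 1) * t ^ (-2 * (n : ℤ) + 1)) with hf
  set U : Set ℝ := Set.Ioo (max ‖z‖ (1 / 4)) 1
  let V : ℕ → Set ℝ := fun j => Set.Ioo ‖z‖ 1 ∩ Set.Ico ((1 / 2) ^ (j + 2)) ((1 / 2) ^ (j + 1))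
  have hcover : Set.Ioo ‖z‖ 1 ⊆ U ∪ ⋃ j, V j := by
    intro t ht
    have ht0 : 0 < t := lt_of_le_of_lt hz0 ht.1
    by_cases h : 1 / 4 < t
    · exact Or.inl ⟨max_lt ht.1 h, ht.2⟩
    · right
      obtain ⟨k, hk1, hk2⟩ := exists_nat_pow_near_of_lt_one ht0 ht.2.le
        (by norm_num : (0 : ℝ) < 1 / 2) (by norm_num)
      have hk : 1 ≤ k := by
        by_contra! hk
        obtain rfl : k = 0 := by omega
        norm_num at hk1 h
        linarith
      obtain ⟨j, rfl⟩ : ∃ j, k = j + 1 := ⟨k - 1, by omega⟩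
      -- The dyadic lemma gives intervals closed on the right, whereas the shells are closed on the
      -- left; a right endpoint belongs to the next shell.
      rcases hk2.lt_or_eq with h' | h'
      · exact Set.mem_iUnion.2 ⟨j, ht, hk1.le, h'⟩
      · rcases j with _ | j
        · exfalso
          norm_num at h' h
          linarith
        · exact Set.mem_iUnion.2 ⟨j, ht, h'.ge, by
            rw [h']; exact pow_lt_pow_right_of_lt_one₀ (by norm_num) (by norm_num) (by omega)⟩
  have hU : ∫⁻ t in U, f t ≤ ENNReal.ofReal (2 ^ (4 * n)) * ENNReal.ofReal ((1 - ‖z‖ ^ 2) ^ n) := by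
    calc ∫⁻ t in U, f t ≤ ∫⁻ _ in U, ENNReal.ofReal ((1 - ‖z‖ ^ 2) ^ (n - 1) * 4 ^ (2 * n - 1)) := by
          refine setLIntegral_mono' measurableSet_Ioo fun t ht => ENNReal.ofReal_le_ofReal ?_
          obtain ⟨h1, h2⟩ := ht
          rw [max_lt_iff] at h1
          have ht0 : 0 < t := by linarith
          rw [green_density_eq hn]
          gcongr
          · apply pow_nonneg; nlinarith
          · nlinarith
          · exact h1.1.le
          · rw [← inv_pow]
            apply pow_le_pow_left₀ (by positivity)
            rw [inv_le_comm₀ ht0 (by norm_num)]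
            linarith
      _ = ENNReal.ofReal ((1 - ‖z‖ ^ 2) ^ (n - 1) * 4 ^ (2 * n - 1)) * volume U :=
          setLIntegral_const _ _
      _ ≤ ENNReal.ofReal ((1 - ‖z‖ ^ 2) ^ (n - 1) * 4 ^ (2 * n - 1)) *
            ENNReal.ofReal (1 - ‖z‖ ^ 2) := by
          gcongr
          rw [Real.volume_Ioo]
          apply ENNReal.ofReal_le_ofReal
          nlinarith [le_max_left ‖z‖ (1 / 4)]
      _ ≤ _ := by
          have h1 : 0 ≤ 1 - ‖z‖ ^ 2 := by nlinarith
          rw [← ENNReal.ofReal_mul (by positivity), ← ENNReal.ofReal_mul (by positivity)]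
          apply ENNReal.ofReal_le_ofReal
          have e : (1 - ‖z‖ ^ 2) ^ (n - 1) * 4 ^ (2 * n - 1) * (1 - ‖z‖ ^ 2) =
              4 ^ (2 * n - 1) * (1 - ‖z‖ ^ 2) ^ n := by
            rw [mul_right_comm, ← pow_succ, Nat.sub_add_cancel hn.le, mul_comm]
          rw [e]
          gcongr
          rw [show (4 : ℝ) = 2 ^ 2 by norm_num, ← pow_mul]
          exact pow_le_pow_right₀ (by norm_num) (by omega)
  have hV : ∀ j, ∫⁻ t in V j, f t ≤ ENNReal.ofReal (2 ^ (4 * n)) *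
      if ‖z‖ < (1 / 2) ^ (j + 1) then ENNReal.ofReal (2 ^ (j * (2 * n - 2))) else 0 := by
    intro j
    split_ifs with hj
    · calc ∫⁻ t in V j, f t ≤ ∫⁻ _ in V j, ENNReal.ofReal ((2 ^ (j + 2)) ^ (2 * n - 1)) := by
            refine setLIntegral_mono' (measurableSet_Ioo.inter measurableSet_Ico) fun t ht =>
              ENNReal.ofReal_le_ofReal ?_
            obtain ⟨⟨h1, h2⟩, h3, h4⟩ := ht
            have ht0 : 0 < t := by linarith
            rw [green_density_eq hn, ← inv_pow]
            refine (mul_le_of_le_one_left (by positivity) ?_).trans ?_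
            · apply pow_le_one₀ <;> nlinarith
            · apply pow_le_pow_left₀ (by positivity)
              rw [inv_le_comm₀ ht0 (by positivity)]
              simpa using h3
        _ = ENNReal.ofReal ((2 ^ (j + 2)) ^ (2 * n - 1)) * volume (V j) := setLIntegral_const _ _
        _ ≤ ENNReal.ofReal ((2 ^ (j + 2)) ^ (2 * n - 1)) * ENNReal.ofReal ((1 / 2) ^ (j + 2)) := by
            gcongr
            refine (measure_mono Set.inter_subset_right).trans ?_
            rw [Real.volume_Ico]
            apply ENNReal.ofReal_le_ofReal
            rw [pow_succ _ (j + 1)]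
            linarith
        _ ≤ _ := by
            rw [← ENNReal.ofReal_mul (by positivity), ← ENNReal.ofReal_mul (by positivity)]
            apply ENNReal.ofReal_le_ofReal
            obtain ⟨m, rfl⟩ : ∃ m, n = m + 1 := ⟨n - 1, by omega⟩
            rw [show 2 * (m + 1) - 1 = 2 * m + 1 by omega, show 2 * (m + 1) - 2 = 2 * m by omega,
              pow_succ, mul_assoc, ← mul_pow, show (2 : ℝ) * (1 / 2) = 1 by norm_num, one_pow,
              mul_one, ← pow_mul, ← pow_add]
            exact pow_le_pow_right₀ (by norm_num) (by nlinarith)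
    · have : V j = ∅ := by
        ext t
        simp only [V, Set.mem_inter_iff, Set.mem_Ioo, Set.mem_Ico, Set.mem_empty_iff_false,
          iff_false]
        rintro ⟨⟨h1, -⟩, -, h4⟩
        linarith
      simp [this]
  calc ∫⁻ t in Set.Ioo ‖z‖ 1, f t ≤ ∫⁻ t in U ∪ ⋃ j, V j, f t := lintegral_mono_set hcover
    _ ≤ (∫⁻ t in U, f t) + ∫⁻ t in ⋃ j, V j, f t := lintegral_union_le _ _ _
    _ ≤ (∫⁻ t in U, f t) + ∑' j, ∫⁻ t in V j, f t := by
        gcongr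
        exact lintegral_iUnion_le _ _
    _ ≤ _ := by
        rw [mul_add, ← ENNReal.tsum_mul_left]
        gcongr with j
        exact hV j

end RadialBounds

/-! ### Upper and lower estimates of `sigma` by comparing cones with boxes. -/

section SphereMeasure

open scoped Pointwise

variable {n : ℕ}

/-- A box in `ℂⁿ`, of sides `x₂ - x₁` and `2 a` in the coordinate `i₀` and `2 b` in the others. -/
def box (i₀ : Fin n) (x₁ x₂ a b : ℝ) : Set (Fin n → ℂ) :=
  Set.pi Set.univ fun i =>
    if i = i₀ then Set.Ioo x₁ x₂ ×ℂ Set.Ioo (-a) a else Set.Ioo (-b) b ×ℂ Set.Ioo (-b) b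

theorem volume_Ioo_reProdIm_Ioo (a b c d : ℝ) :
    volume (Set.Ioo a b ×ℂ Set.Ioo c d) = ENNReal.ofReal (b - a) * ENNReal.ofReal (d - c) := by
  have h : Set.Ioo a b ×ℂ Set.Ioo c d =
      Complex.measurableEquivRealProd ⁻¹' (Set.Ioo a b ×ˢ Set.Ioo c d) := by
    ext z; simp [Complex.mem_reProdIm]
  rw [h, Complex.volume_preserving_equiv_real_prod.measure_preimage
    (measurableSet_Ioo.prod measurableSet_Ioo).nullMeasurableSet, Measure.volume_eq_prod,
    Measure.prod_prod, Real.volume_Ioo, Real.volume_Ioo]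

theorem isOpen_box (i₀ : Fin n) (x₁ x₂ a b : ℝ) : IsOpen (box i₀ x₁ x₂ a b) := by
  refine isOpen_set_pi Set.finite_univ fun i _ => ?_
  split_ifs <;> exact isOpen_Ioo.reProdIm isOpen_Ioo

theorem volume_box (i₀ : Fin n) {x₁ x₂ a b : ℝ} (hx : x₁ ≤ x₂) (ha : 0 ≤ a) (hb : 0 ≤ b) :
    volume (box i₀ x₁ x₂ a b) =
      ENNReal.ofReal ((x₂ - x₁) * (2 * a) * ((2 * b) ^ 2) ^ (n - 1)) := by
  rw [box, volume_pi_pi, ← Finset.mul_prod_erase _ _ (Finset.mem_univ i₀), if_pos rfl]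
  rw [Finset.prod_congr rfl (g := fun _ => ENNReal.ofReal ((2 * b) ^ 2))]
  · rw [Finset.prod_const, Finset.card_erase_of_mem (Finset.mem_univ _), Finset.card_univ,
      Fintype.card_fin, volume_Ioo_reProdIm_Ioo, ENNReal.ofReal_mul (by nlinarith),
      ENNReal.ofReal_mul (by linarith), ENNReal.ofReal_pow (p := (2 * b) ^ 2) (by positivity),
      sub_neg_eq_add, two_mul a]
  · intro i hi
    rw [if_neg (Finset.ne_of_mem_erase hi), volume_Ioo_reProdIm_Ioo,
      ← ENNReal.ofReal_mul (by linarith)]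
    ring_nf

/-- Uniqueness of Haar measure. The value of the constant is irrelevant: it is absorbed in the
constants of the sphere estimates. -/
theorem exists_volume_ofLp_preimage (n : ℕ) : ∃ c : ℝ≥0∞, c ≠ 0 ∧ c ≠ ∞ ∧
    ∀ s : Set (Fin n → ℂ), MeasurableSet s →
      volume ((fun z : Cn n => z.ofLp) ⁻¹' s) = c * volume s := by
  let L := PiLp.continuousLinearEquiv 2 ℝ (fun _ : Fin n => ℂ)
  have := L.isAddHaarMeasure_map (volume : Measure (Cn n))
  have h2 := Measure.isAddLeftInvariant_eq_smul
    (Measure.map L (volume : Measure (Cn n))) volume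
  refine ⟨_, ENNReal.coe_ne_zero.2 (Measure.addHaarScalarFactor_pos_of_isAddHaarMeasure
    (Measure.map L (volume : Measure (Cn n))) volume).ne', ENNReal.coe_ne_top, fun s hs => ?_⟩
  have h3 := congrArg (fun m : Measure (Fin n → ℂ) => m s) h2
  simp only [Measure.smul_apply, ENNReal.smul_def, smul_eq_mul] at h3
  rw [← h3, Measure.map_apply L.continuous.measurable hs]
  rfl

/-- Completing ζ to an orthonormal basis turns ⟨z, ζ⟩ into a coordinate, so that sets described by
⟨z, ζ⟩ and its orthogonal complement can be compared with boxes. -/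
theorem exists_unitary (i₀ : Fin n) (ζ : Cn n) (hζ : ‖ζ‖ = 1) :
    ∃ U : Cn n ≃ₗᵢ[ℂ] Cn n, MeasurePreserving U ∧ ∀ z, (U z).ofLp i₀ = herm z ζ := by
  have ho : Orthonormal ℂ (({i₀} : Set (Fin n)).domRestrict fun _ => ζ) := by
    refine ⟨fun i => hζ, fun i j hij => ?_⟩
    exact absurd (Subtype.ext (i.2.trans j.2.symm)) hij
  obtain ⟨b, hb⟩ := ho.exists_orthonormalBasis_extension_of_card_eq (by simp)
  refine ⟨b.repr, ?_, fun z => ?_⟩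
  · let V : Cn n ≃ₗᵢ[ℝ] Cn n :=
      { toLinearEquiv := b.repr.toLinearEquiv.restrictScalars ℝ
        norm_map' := b.repr.norm_map }
    exact V.measurePreserving
  · rw [b.repr_apply_apply, hb i₀ rfl, herm_eq_inner]

theorem sum_erase_norm_sq (i₀ : Fin n) {ζ : Cn n} (hζ : ‖ζ‖ = 1) {U : Cn n ≃ₗᵢ[ℂ] Cn n}
    (hU : ∀ z, (U z).ofLp i₀ = herm z ζ) (z : Cn n) :
    ∑ i ∈ Finset.univ.erase i₀, ‖(U z).ofLp i‖ ^ 2 = ‖z - herm z ζ • ζ‖ ^ 2 := by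
  rw [norm_sub_proj_sq z ζ hζ, ← U.norm_map z, EuclideanSpace.norm_sq_eq,
    ← Finset.add_sum_erase _ _ (Finset.mem_univ i₀), hU]
  ring

theorem sigma_apply {A : Set (S n)} (hA : MeasurableSet A) :
    sigma n A = ((volume : Measure (Cn n)).toSphere Set.univ)⁻¹ *
      ((Module.finrank ℝ (Cn n) : ℝ≥0∞) * volume (Set.Ioo (0 : ℝ) 1 • (Subtype.val '' A))) := by
  rw [sigma, Measure.smul_apply, smul_eq_mul, Measure.toSphere_apply' _ hA]

theorem finrank_Cn (n : ℕ) : Module.finrank ℝ (Cn n) = 2 * n := by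
  rw [← Module.finrank_mul_finrank ℝ ℂ (Cn n), Complex.finrank_real_complex]
  simp

theorem toSphere_univ_ne_zero (hn : 0 < n) :
    (volume : Measure (Cn n)).toSphere Set.univ ≠ 0 := by
  have : Nonempty (Fin n) := ⟨⟨0, hn⟩⟩
  rw [Measure.measure_univ_ne_zero]
  exact Measure.toSphere_ne_zero _

theorem isProbabilityMeasure_sigma (hn : 0 < n) : IsProbabilityMeasure (sigma n) := by
  refine ⟨?_⟩
  rw [sigma, Measure.smul_apply, smul_eq_mul]
  exact ENNReal.inv_mul_cancel (toSphere_univ_ne_zero hn) (measure_ne_top _ _)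

theorem continuous_herm : Continuous fun x : Cn n × Cn n => herm x.1 x.2 := by
  unfold herm
  fun_prop

/-- The part of the sphere near the complex line through `ζ`, with small imaginary part. -/
theorem exists_sigma_le (hn : 0 < n) : ∃ K : ℝ, 0 < K ∧ ∀ (ζ : Cn n) (a b : ℝ), ‖ζ‖ = 1 →
    0 < a → 0 < b →
      sigma n {ξ | |(herm (ξ : Cn n) ζ).im| < a ∧ ‖(ξ : Cn n) - herm (ξ : Cn n) ζ • ζ‖ < b} ≤
        ENNReal.ofReal (K * (a * (b ^ 2) ^ (n - 1))) := by
  obtain ⟨c, hc0, hc, hvol⟩ := exists_volume_ofLp_preimage n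
  let i₀ : Fin n := ⟨0, hn⟩
  set κ := ((volume : Measure (Cn n)).toSphere Set.univ)⁻¹
  have hκ : κ ≠ ∞ := ENNReal.inv_ne_top.2 (toSphere_univ_ne_zero hn)
  set M : ℝ≥0∞ := κ * ((Module.finrank ℝ (Cn n) : ℝ≥0∞) * c)
  have hM : M ≠ ∞ := ENNReal.mul_ne_top hκ (ENNReal.mul_ne_top (ENNReal.natCast_ne_top _) hc)
  refine ⟨M.toReal * (8 * 4 ^ (n - 1)) + 1, by positivity, fun ζ a b hζ ha hb => ?_⟩
  obtain ⟨U, hUm, hU⟩ := exists_unitary i₀ ζ hζ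
  have hc1 : Continuous fun ξ : S n => herm (ξ : Cn n) ζ :=
    continuous_herm.comp (continuous_subtype_val.prodMk continuous_const)
  have hA : MeasurableSet
      {ξ : S n | |(herm (ξ : Cn n) ζ).im| < a ∧ ‖(ξ : Cn n) - herm (ξ : Cn n) ζ • ζ‖ < b} := by
    apply IsOpen.measurableSet
    apply IsOpen.inter
    · exact isOpen_lt (Complex.continuous_im.comp hc1).abs continuous_const
    · exact isOpen_lt (continuous_subtype_val.sub (hc1.smul continuous_const)).norm continuous_const
  rw [sigma_apply hA]
  -- The sphere measure is the normalized volume of the cone over the set; scaling by t < 1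
  -- preserves the bounds a and b, so the rotated cone lies in a box.
  have hsub : Set.Ioo (0 : ℝ) 1 • (Subtype.val ''
      {ξ : S n | |(herm (ξ : Cn n) ζ).im| < a ∧ ‖(ξ : Cn n) - herm (ξ : Cn n) ζ • ζ‖ < b}) ⊆
      U ⁻¹' ((fun z : Cn n => z.ofLp) ⁻¹' box i₀ (-2) 2 a b) := by
    rintro _ ⟨t, ⟨ht0, ht1⟩, _, ⟨ξ, ⟨h1, h2⟩, rfl⟩, rfl⟩
    have hξ : ‖(ξ : Cn n)‖ = 1 := by simp
    simp only [Set.mem_preimage, box, Set.mem_pi, Set.mem_univ, forall_const]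
    intro i
    have e : (U (t • (ξ : Cn n))).ofLp i = (t : ℂ) * (U (ξ : Cn n)).ofLp i := by
      rw [real_smul_eq, map_smul]; simp
    rw [e]
    split_ifs with hi
    · subst hi
      rw [hU]
      have h3 : |(herm (ξ : Cn n) ζ).re| ≤ 1 :=
        (Complex.abs_re_le_norm _).trans ((norm_herm_le _ _).trans (by rw [hξ, hζ]; norm_num))
      rw [abs_le] at h3
      rw [abs_lt] at h1
      simp only [Complex.mem_reProdIm, Set.mem_Ioo, Complex.re_ofReal_mul, Complex.im_ofReal_mul]
      refine ⟨⟨?_, ?_⟩, ?_, ?_⟩ <;> nlinarith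
    · have h3 : ‖(U (ξ : Cn n)).ofLp i‖ < b := by
        have h4 : ‖(U (ξ : Cn n)).ofLp i‖ ^ 2 ≤ ‖(ξ : Cn n) - herm (ξ : Cn n) ζ • ζ‖ ^ 2 := by
          rw [← sum_erase_norm_sq i₀ hζ hU]
          exact Finset.single_le_sum (f := fun i => ‖(U (ξ : Cn n)).ofLp i‖ ^ 2)
            (fun _ _ => by positivity) (Finset.mem_erase.2 ⟨hi, Finset.mem_univ _⟩)
        exact lt_of_le_of_lt (abs_le_of_sq_le_sq' h4 (norm_nonneg _)).2 h2
      have h5 := (Complex.abs_re_le_norm ((U (ξ : Cn n)).ofLp i)).trans_lt h3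
      have h6 := (Complex.abs_im_le_norm ((U (ξ : Cn n)).ofLp i)).trans_lt h3
      rw [abs_lt] at h5 h6
      simp only [Complex.mem_reProdIm, Set.mem_Ioo, Complex.re_ofReal_mul, Complex.im_ofReal_mul]
      refine ⟨⟨?_, ?_⟩, ?_, ?_⟩ <;> nlinarith
  have hbox := (isOpen_box i₀ (-2) 2 a b).measurableSet
  calc κ * ((Module.finrank ℝ (Cn n) : ℝ≥0∞) * volume (Set.Ioo (0 : ℝ) 1 • (Subtype.val ''
      {ξ : S n | |(herm (ξ : Cn n) ζ).im| < a ∧ ‖(ξ : Cn n) - herm (ξ : Cn n) ζ • ζ‖ < b})))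
      ≤ κ * ((Module.finrank ℝ (Cn n) : ℝ≥0∞) *
        volume (U ⁻¹' ((fun z : Cn n => z.ofLp) ⁻¹' box i₀ (-2) 2 a b))) := by
        gcongr
    _ = M * ENNReal.ofReal ((2 - (-2)) * (2 * a) * ((2 * b) ^ 2) ^ (n - 1)) := by
        rw [hUm.measure_preimage, hvol _ hbox, volume_box i₀ (by norm_num) ha.le hb.le]
        · ring
        · exact (WithLp.measurable_ofLp 2 _ hbox).nullMeasurableSet
    _ ≤ _ := by
        rw [← ENNReal.ofReal_toReal hM, ← ENNReal.ofReal_mul ENNReal.toReal_nonneg]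
        apply ENNReal.ofReal_le_ofReal
        rw [mul_pow 2 b, mul_pow]
        have : 0 ≤ a * (b ^ 2) ^ (n - 1) := by positivity
        norm_num
        linarith

/-- Nonisotropic balls of radius `√δ` in the sphere have measure at least `c δⁿ`. -/
theorem exists_le_sigma (hn : 0 < n) : ∃ c : ℝ, 0 < c ∧ ∀ (ζ : Cn n) (δ : ℝ), ‖ζ‖ = 1 →
    0 < δ → δ ≤ 1 →
      ENNReal.ofReal (c * δ ^ n) ≤ sigma n {ξ | ‖1 - herm (ξ : Cn n) ζ‖ < δ} := by
  obtain ⟨c, hc0, hc, hvol⟩ := exists_volume_ofLp_preimage n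
  let i₀ : Fin n := ⟨0, hn⟩
  set κ := ((volume : Measure (Cn n)).toSphere Set.univ)⁻¹
  have hκ : κ ≠ ∞ := ENNReal.inv_ne_top.2 (toSphere_univ_ne_zero hn)
  have hκ0 : κ ≠ 0 := ENNReal.inv_ne_zero.2 (measure_ne_top _ _)
  set M : ℝ≥0∞ := κ * ((Module.finrank ℝ (Cn n) : ℝ≥0∞) * c)
  have hM : M ≠ ∞ := ENNReal.mul_ne_top hκ (ENNReal.mul_ne_top (ENNReal.natCast_ne_top _) hc)
  have hM0 : M ≠ 0 := by
    refine mul_ne_zero hκ0 (mul_ne_zero ?_ hc0)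
    rw [finrank_Cn]
    exact_mod_cast (by omega : 2 * n ≠ 0)
  have hMpos : 0 < M.toReal := ENNReal.toReal_pos hM0 hM
  have hn0 : (0 : ℝ) < n := by exact_mod_cast hn
  set q : ℝ := (4 * (1 / 512 / n)) ^ (n - 1) with hq
  refine ⟨M.toReal * (1 / 4 * (1 / 8) * q), by positivity, fun ζ δ hζ hδ hδ1 => ?_⟩
  obtain ⟨U, hUm, hU⟩ := exists_unitary i₀ ζ hζ
  have hc1 : Continuous fun ξ : S n => herm (ξ : Cn n) ζ :=
    continuous_herm.comp (continuous_subtype_val.prodMk continuous_const)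
  have hA : MeasurableSet {ξ : S n | ‖1 - herm (ξ : Cn n) ζ‖ < δ} :=
    (isOpen_lt (by fun_prop) continuous_const).measurableSet
  rw [sigma_apply hA]
  set a := δ / 16 with ha
  set b := Real.sqrt (δ / 512 / n) with hb
  have hb2 : b ^ 2 = δ / 512 / n := Real.sq_sqrt (by positivity)
  -- Conversely, a rotated box lies in the cone. Its points have real part x of ⟨z, ζ⟩ in (1/4,
  -- 1/2), and |z|² - x² ≤ δ/128 forces |z| - x ≤ δ/64; after division by |z| > 1/4 the error (1/64
  -- + 1/16)δ is still below δ.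
  have hsub : U ⁻¹' ((fun z : Cn n => z.ofLp) ⁻¹' box i₀ (1 / 4) (1 / 2) a b) ⊆
      Set.Ioo (0 : ℝ) 1 • (Subtype.val '' {ξ : S n | ‖1 - herm (ξ : Cn n) ζ‖ < δ}) := by
    intro z hz
    simp only [Set.mem_preimage, box, Set.mem_pi, Set.mem_univ, forall_const] at hz
    have h0 := hz i₀
    rw [if_pos rfl, hU] at h0
    simp only [Complex.mem_reProdIm, Set.mem_Ioo] at h0
    obtain ⟨⟨h1, h2⟩, h3, h4⟩ := h0
    have h5 : ‖z - herm z ζ • ζ‖ ^ 2 ≤ δ / 256 := by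
      rw [← sum_erase_norm_sq i₀ hζ hU]
      calc ∑ i ∈ Finset.univ.erase i₀, ‖(U z).ofLp i‖ ^ 2
          ≤ ∑ i ∈ Finset.univ.erase i₀, δ / 256 / n := by
            refine Finset.sum_le_sum fun i hi => ?_
            have h6 := hz i
            rw [if_neg (Finset.ne_of_mem_erase hi)] at h6
            simp only [Complex.mem_reProdIm, Set.mem_Ioo] at h6
            obtain ⟨⟨h7, h8⟩, h9, h10⟩ := h6
            rw [← Complex.normSq_eq_norm_sq, Complex.normSq_apply]
            have : δ / 256 / n = b ^ 2 + b ^ 2 := by rw [hb2]; ring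
            rw [this]
            nlinarith
        _ ≤ ∑ i : Fin n, δ / 256 / n :=
            Finset.sum_le_sum_of_subset_of_nonneg (Finset.erase_subset _ _)
              (fun _ _ _ => by positivity)
        _ = δ / 256 := by
            rw [Finset.sum_const, Finset.card_univ, Fintype.card_fin, nsmul_eq_mul]
            field_simp
    have h6 := norm_sub_proj_sq z ζ hζ
    rw [← Complex.normSq_eq_norm_sq, Complex.normSq_apply] at h6
    set x := (herm z ζ).re
    set y := (herm z ζ).im
    set ρ := ‖z‖ with hρ
    have hρ0 : 0 ≤ ρ := norm_nonneg z
    have hy2 : y * y ≤ δ / 256 := by nlinarith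
    have hxρ : x ≤ ρ := by nlinarith [sq_nonneg ‖z - herm z ζ • ζ‖, mul_self_nonneg y]
    have hρ1 : ρ < 1 := by nlinarith
    have hρpos : 0 < ρ := by linarith
    have hdiff : ρ - x ≤ δ / 64 := by nlinarith
    have hnorm : ‖ρ⁻¹ • z‖ = 1 := by
      rw [norm_smul, norm_inv, Real.norm_of_nonneg hρ0, inv_mul_cancel₀ hρpos.ne']
    refine ⟨ρ, ⟨hρpos, hρ1⟩, ρ⁻¹ • z, ⟨⟨ρ⁻¹ • z, by simpa using hnorm⟩, ?_, rfl⟩, ?_⟩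
    · change ‖1 - herm (ρ⁻¹ • z) ζ‖ < δ
      rw [real_smul_eq, herm_smul_left]
      have e : 1 - ((ρ⁻¹ : ℝ) : ℂ) * herm z ζ = ((ρ⁻¹ : ℝ) : ℂ) * ((ρ : ℂ) - herm z ζ) := by
        rw [mul_sub, ← Complex.ofReal_mul, inv_mul_cancel₀ hρpos.ne', Complex.ofReal_one]
      rw [e, norm_mul, Complex.norm_real, norm_inv, Real.norm_of_nonneg hρ0]
      have h7 : ‖(ρ : ℂ) - herm z ζ‖ ≤ δ / 64 + δ / 16 := by
        refine (Complex.norm_le_abs_re_add_abs_im _).trans ?_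
        simp only [Complex.sub_re, Complex.ofReal_re, Complex.sub_im, Complex.ofReal_im]
        apply add_le_add
        · rw [abs_le]; constructor <;> linarith
        · rw [abs_le]; constructor <;> linarith
      rw [inv_mul_lt_iff₀ hρpos]
      nlinarith
    · simp [smul_smul, hρpos.ne']
  have hbox := (isOpen_box i₀ (1 / 4) (1 / 2) a b).measurableSet
  calc ENNReal.ofReal (M.toReal * (1 / 4 * (1 / 8) * q) * δ ^ n)
      = M * ENNReal.ofReal ((1 / 2 - 1 / 4) * (2 * a) * ((2 * b) ^ 2) ^ (n - 1)) := by
        conv_rhs => rw [← ENNReal.ofReal_toReal hM]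
        rw [← ENNReal.ofReal_mul ENNReal.toReal_nonneg]
        congr 1
        have e1 : ((2 * b) ^ 2) ^ (n - 1) = q * δ ^ (n - 1) := by
          rw [mul_pow 2 b, hb2, hq, ← mul_pow]
          congr 1
          ring
        have e2 : δ ^ n = δ ^ (n - 1) * δ := by rw [← pow_succ, Nat.sub_add_cancel hn]
        rw [e1, e2, ha]
        ring
    _ = κ * ((Module.finrank ℝ (Cn n) : ℝ≥0∞) *
        volume (U ⁻¹' ((fun z : Cn n => z.ofLp) ⁻¹' box i₀ (1 / 4) (1 / 2) a b))) := by
        rw [hUm.measure_preimage, hvol _ hbox, volume_box i₀ (by norm_num) (by positivity)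
          (Real.sqrt_nonneg _)]
        · ring
        · exact (WithLp.measurable_ofLp 2 _ hbox).nullMeasurableSet
    _ ≤ _ := by gcongr

end SphereMeasure

/-! ### Pseudohyperbolic balls `near` and the averaging estimate over the sphere. -/

section LocalSets

variable {n : ℕ}

theorem continuous_herm_comp {X : Type*} [TopologicalSpace X] {f h : X → Cn n}
    (hf : Continuous f) (hh : Continuous h) : Continuous fun x => herm (f x) (h x) :=
  continuous_herm.comp (hf.prodMk hh)

theorem mem_C {ξ : S n} {δ : ℝ} {w : B n} : w ∈ C ξ δ ↔ ‖1 - herm (w : Cn n) (ξ : Cn n)‖ < δ := by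
  simp only [C, aniso, Set.mem_ofPred_eq]
  exact Real.sqrt_lt_sqrt_iff (norm_nonneg _)

theorem norm_coe_sphere (ξ : S n) : ‖(ξ : Cn n)‖ = 1 := by simp

theorem norm_coe_ball (w : B n) : ‖(w : Cn n)‖ < 1 :=
  mem_ball_zero_iff.1 w.2

theorem norm_smul_sphere (ξ : S n) {r : ℝ} (hr : 0 ≤ r) : ‖r • (ξ : Cn n)‖ = r := by
  rw [norm_smul, norm_coe_sphere, mul_one, Real.norm_of_nonneg hr]

/-- The points `w` of the ball with `|φ_w(z)| < s`, for `z` in the ball. -/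
def near (z : Cn n) (s : ℝ) : Set (B n) :=
  {w | (1 - s ^ 2) * ‖1 - herm z (w : Cn n)‖ ^ 2 < (1 - ‖(w : Cn n)‖ ^ 2) * (1 - ‖z‖ ^ 2)}

theorem mem_near_iff {z : Cn n} (hz : ‖z‖ < 1) {s : ℝ} (hs : 0 ≤ s) {w : B n} :
    w ∈ near z s ↔ ‖phi (w : Cn n) z‖ < s := by
  have hw := norm_coe_ball w
  have hpos : 0 < ‖1 - herm z (w : Cn n)‖ :=
    lt_of_lt_of_le (by linarith) (one_sub_norm_le_left hw.le)
  have h := norm_phi_sq_mul hz hw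
  rw [← pow_lt_pow_iff_left₀ (norm_nonneg _) hs two_ne_zero]
  simp only [near, Set.mem_ofPred_eq]
  constructor
  · intro h1
    by_contra! h2
    nlinarith [mul_le_mul_of_nonneg_right h2 (sq_nonneg ‖1 - herm z (w : Cn n)‖)]
  · intro h1
    nlinarith [mul_lt_mul_of_pos_right h1 (sq_pos_of_pos hpos)]

/-- Put m = |1 - ⟨z, w⟩|, which dominates both 1 - |z| and 1 - |w|. For s ≤ 1/2 membership gives 3m²
< 16(1 - |z|)(1 - |w|), whereas m ≥ 6(1 - |z|) or m ≥ 6(1 - |w|) would give 3m² ≥ 18(1 - |z|)(1 -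
|w|). -/
theorem near_bounds {z : Cn n} (hz : ‖z‖ < 1) {s : ℝ} (hs : 0 ≤ s) (hs' : s ≤ 1 / 2) {w : B n}
    (h : w ∈ near z s) :
    1 - ‖z‖ < 6 * (1 - ‖(w : Cn n)‖) ∧ ‖1 - herm z (w : Cn n)‖ < 6 * (1 - ‖z‖) ∧
      1 - ‖(w : Cn n)‖ < 6 * (1 - ‖z‖) := by
  have hw := norm_coe_ball w
  have h1 := one_sub_norm_le_left (z := z) hw.le
  have h2 := one_sub_norm_le_right (w := (w : Cn n)) hz.le
  simp only [near, Set.mem_ofPred_eq] at h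
  set m := ‖1 - herm z (w : Cn n)‖
  set a := 1 - ‖(w : Cn n)‖ with ha
  set b := 1 - ‖z‖ with hb
  have ha0 : 0 < a := by linarith
  have hb0 : 0 < b := by linarith
  have e1 : 1 - ‖(w : Cn n)‖ ^ 2 = a * (1 + ‖(w : Cn n)‖) := by rw [ha]; ring
  have e2 : 1 - ‖z‖ ^ 2 = b * (1 + ‖z‖) := by rw [hb]; ring
  have h3 : (1 - ‖(w : Cn n)‖ ^ 2) * (1 - ‖z‖ ^ 2) ≤ (a * 2) * (b * 2) := by
    rw [e1, e2]
    gcongr <;> linarith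
  have h4 : 3 / 4 * m ^ 2 ≤ (1 - s ^ 2) * m ^ 2 := by
    gcongr
    nlinarith
  have h5 : 3 * m ^ 2 < 16 * (a * b) := by linarith
  have hmb : m < 6 * b := by
    by_contra! hc
    nlinarith
  have hma : m < 6 * a := by
    by_contra! hc
    nlinarith
  exact ⟨by linarith, hmb, by linarith⟩

/-- With w = tζ and z = rξ, `norm_one_sub_herm_sq_sub` bounds |t - ⟨z, ζ⟩|² + (1 - t²)|z - ⟨z, ζ⟩ζ|²
by s²(6δ)². Since 1 - t² ≥ δ/6, the imaginary part of ⟨ξ, ζ⟩ is O(sδ) and the orthogonal part of ξ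
is O(s√δ), so the measure is O(sδ (s²δ)^(n-1)). -/
theorem exists_sigma_near_le (hn : 0 < n) : ∃ K : ℝ, 0 < K ∧ ∀ (w : B n) (r s : ℝ),
    1 / 2 ≤ r → r < 1 → 0 < s → s ≤ 1 / 2 →
      sigma n {ξ | w ∈ near (r • (ξ : Cn n)) s} ≤
        ENNReal.ofReal (K * s ^ (2 * n - 1) * (1 - r) ^ n) := by
  obtain ⟨K, hK, hsig⟩ := exists_sigma_le (n := n) hn
  refine ⟨K * (12 * 900 ^ (n - 1)), by positivity, fun w r s hr hr1 hs hs' => ?_⟩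
  have hr0 : 0 ≤ r := by linarith
  by_cases hw0 : (w : Cn n) = 0
  · have : {ξ : S n | w ∈ near (r • (ξ : Cn n)) s} = ∅ := by
      ext ξ
      simp only [near, Set.mem_ofPred_eq, Set.mem_empty_iff_false, iff_false, hw0, herm_zero_right,
        norm_smul_sphere ξ hr0]
      simp
      nlinarith
    simp [this]
  obtain ⟨ζ, hζ, hwζ⟩ := exists_unit_smul (w : Cn n) hw0
  set δ := 1 - r with hδ
  have hδ0 : 0 < δ := by linarith
  have hb2 : (30 * s * Real.sqrt δ) ^ 2 = 900 * s ^ 2 * δ := by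
    rw [mul_pow, Real.sq_sqrt hδ0.le]; ring
  refine (measure_mono ?_).trans ((hsig ζ (12 * s * δ) (30 * s * Real.sqrt δ) hζ
    (by positivity) (by positivity)).trans (ENNReal.ofReal_le_ofReal (le_of_eq ?_)))
  · intro ξ hξ
    have hz : ‖r • (ξ : Cn n)‖ < 1 := by rw [norm_smul_sphere ξ hr0]; exact hr1
    obtain ⟨h1, h2, h3⟩ := near_bounds hz hs.le hs' hξ
    have hid := norm_one_sub_herm_sq_sub (r • (ξ : Cn n)) ζ hζ ‖(w : Cn n)‖
    rw [← hwζ] at hid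
    have hξ' : (1 - s ^ 2) * ‖1 - herm (r • (ξ : Cn n)) (w : Cn n)‖ ^ 2 <
      (1 - ‖(w : Cn n)‖ ^ 2) * (1 - ‖r • (ξ : Cn n)‖ ^ 2) := hξ
    rw [norm_smul_sphere ξ hr0] at h1 h2 h3 hξ' hid
    have hm : ‖1 - herm (r • (ξ : Cn n)) (w : Cn n)‖ ^ 2 ≤ (6 * δ) ^ 2 := by gcongr
    have e1 : r • (ξ : Cn n) - herm (r • (ξ : Cn n)) ζ • ζ =
        (r : ℂ) • ((ξ : Cn n) - herm (ξ : Cn n) ζ • ζ) := by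
      rw [real_smul_eq, herm_smul_left, smul_sub, smul_smul]
    rw [e1, norm_smul, Complex.norm_real, Real.norm_of_nonneg hr0, mul_pow] at hid
    set X := ‖(ξ : Cn n) - herm (ξ : Cn n) ζ • ζ‖ with hX
    set m := ‖1 - herm (r • (ξ : Cn n)) (w : Cn n)‖
    have hw1 := norm_coe_ball w
    have ht : δ / 6 ≤ 1 - ‖(w : Cn n)‖ ^ 2 := by nlinarith [norm_nonneg (w : Cn n)]
    have hsm : s ^ 2 * m ^ 2 ≤ s ^ 2 * (6 * δ) ^ 2 := by gcongr
    have him : ‖(‖(w : Cn n)‖ : ℂ) - herm (r • (ξ : Cn n)) ζ‖ ^ 2 < (6 * s * δ) ^ 2 := by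
      nlinarith [mul_nonneg (by linarith : 0 ≤ 1 - ‖(w : Cn n)‖ ^ 2)
        (by positivity : 0 ≤ r ^ 2 * X ^ 2)]
    have hX2 : (1 - ‖(w : Cn n)‖ ^ 2) * (r ^ 2 * X ^ 2) < s ^ 2 * (6 * δ) ^ 2 := by
      nlinarith [sq_nonneg ‖(‖(w : Cn n)‖ : ℂ) - herm (r • (ξ : Cn n)) ζ‖]
    refine ⟨?_, ?_⟩
    · have h5 := lt_of_pow_lt_pow_left₀ 2 (by positivity) him
      have h6 := (Complex.abs_im_le_norm _).trans_lt h5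
      rw [real_smul_eq, herm_smul_left] at h6
      simp only [Complex.sub_im, Complex.ofReal_im, Complex.im_ofReal_mul, zero_sub, abs_neg,
        abs_mul, abs_of_nonneg hr0] at h6
      nlinarith [abs_nonneg (herm (ξ : Cn n) ζ).im]
    · refine lt_of_pow_lt_pow_left₀ 2 (by positivity) ?_
      rw [hb2, ← hX]
      have h7 : δ / 6 * (1 / 4 * X ^ 2) ≤ (1 - ‖(w : Cn n)‖ ^ 2) * (r ^ 2 * X ^ 2) := by
        have hr4 : 1 / 4 ≤ r ^ 2 := by nlinarith
        have ht0 : 0 ≤ 1 - ‖(w : Cn n)‖ ^ 2 := by linarith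
        gcongr
      have h8 : δ * X ^ 2 < δ * (900 * s ^ 2 * δ) := by
        have : 0 < s ^ 2 * δ ^ 2 := by positivity
        nlinarith
      exact lt_of_mul_lt_mul_left h8 hδ0.le
  · obtain ⟨m, rfl⟩ : ∃ m, n = m + 1 := ⟨n - 1, by omega⟩
    rw [hb2, show 2 * (m + 1) - 1 = 2 * m + 1 by omega, Nat.add_sub_cancel, mul_pow, mul_pow,
      ← pow_mul]
    ring

theorem lintegral_setLIntegral_swap {X Y : Type*} [MeasurableSpace X] [MeasurableSpace Y]
    (μ : Measure X) (ν : Measure Y) [SFinite μ] [SFinite ν] {T : Set (X × Y)}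
    (hT : MeasurableSet T) {H : Y → ℝ≥0∞} (hH : Measurable H) :
    ∫⁻ x, ∫⁻ y in {y | (x, y) ∈ T}, H y ∂ν ∂μ = ∫⁻ y, H y * μ {x | (x, y) ∈ T} ∂ν := by
  have h1 : ∀ x, ∫⁻ y in {y | (x, y) ∈ T}, H y ∂ν =
      ∫⁻ y, T.indicator (fun q => H q.2) (x, y) ∂ν := by
    intro x
    exact (lintegral_indicator (measurable_prodMk_left hT) _).symm
  have h2 : ∀ y, H y * μ {x | (x, y) ∈ T} = ∫⁻ x, T.indicator (fun q => H q.2) (x, y) ∂μ := by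
    intro y
    rw [← setLIntegral_const]
    exact (lintegral_indicator (measurable_prodMk_right hT) _).symm
  simp_rw [h1, h2]
  exact lintegral_lintegral_swap ((hH.comp measurable_snd).indicator hT).aemeasurable

theorem isOpen_near (r s : ℝ) :
    IsOpen {q : S n × B n | q.2 ∈ near (r • (q.1 : Cn n)) s} := by
  have h1 : Continuous fun q : S n × B n => herm (r • (q.1 : Cn n)) (q.2 : Cn n) := by
    refine continuous_herm_comp (f := fun q : S n × B n => r • (q.1 : Cn n)) ?_ ?_ <;> fun_prop
  simp only [near, Set.mem_ofPred_eq]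
  exact isOpen_lt (by fun_prop) (by fun_prop)

theorem isOpen_C (δ : ℝ) : IsOpen {q : S n × B n | q.2 ∈ C q.1 δ} := by
  have h1 : Continuous fun q : S n × B n => herm (q.2 : Cn n) (q.1 : Cn n) :=
    continuous_herm_comp (by fun_prop) (by fun_prop)
  simp_rw [mem_C]
  exact isOpen_lt (by fun_prop) continuous_const

theorem measurable_measure_C (lm : Measure (B n)) [SFinite lm] (δ : ℝ) :
    Measurable fun ξ : S n => lm (C ξ δ) :=
  measurable_measure_prodMk_left (isOpen_C δ).measurableSet

theorem measurable_measure_near (lm : Measure (B n)) [SFinite lm] (r s : ℝ) :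
    Measurable fun ξ : S n => lm (near (r • (ξ : Cn n)) s) :=
  measurable_measure_prodMk_left (isOpen_near r s).measurableSet

theorem rpow_eq_rpow_sub_one_mul {p : ℝ} (hp : 1 ≤ p) (x : ℝ≥0∞) : x ^ p = x ^ (p - 1) * x := by
  conv_rhs => rw [← ENNReal.rpow_one x, ← ENNReal.rpow_mul, one_mul]
  rw [← ENNReal.rpow_add_of_nonneg _ _ (by linarith) zero_le_one, sub_add_cancel]

/-- Write λ(N)^p as the integral over N of the constant λ(N)^(p-1), and enlarge that constant to a
function of w alone. Tonelli then isolates σ{ξ : w ∈ N}, which is at most a multiple of s^(2n-1)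
times the measure of a cap of radius comparable to δ around w; a second use of Tonelli restores a
power of λ(C). -/
theorem exists_lintegral_near_rpow_le (hn : 0 < n) {p : ℝ} (hp : 1 ≤ p) :
    ∃ K : ℝ, 0 < K ∧ ∀ (lm : Measure (B n)) [IsFiniteMeasure lm] (r s : ℝ),
      5 / 6 ≤ r → r < 1 → 0 < s → s ≤ 1 / 2 →
        ∫⁻ ξ : S n, lm (near (r • (ξ : Cn n)) s) ^ p ∂(sigma n) ≤
          ENNReal.ofReal (K * s ^ (2 * n - 1)) *
            ∫⁻ ξ : S n, lm (C ξ (220 * (1 - r))) ^ p ∂(sigma n) := by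
  have := isProbabilityMeasure_sigma hn
  obtain ⟨K, hK, hup⟩ := exists_sigma_near_le hn
  obtain ⟨c, hc, hlow⟩ := exists_le_sigma hn
  refine ⟨K / c, by positivity, fun lm _ r s hr hr1 hs hs' => ?_⟩
  have hr0 : 0 ≤ r := by linarith
  set δ := 1 - r with hδ
  have hδ0 : 0 < δ := by linarith
  have hD : IsOpen {q : B n × B n | ‖1 - herm (q.2 : Cn n) (q.1 : Cn n)‖ < 48 * δ} := by
    have h1 : Continuous fun q : B n × B n => herm (q.2 : Cn n) (q.1 : Cn n) :=
      continuous_herm_comp (by fun_prop) (by fun_prop)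
    exact isOpen_lt (by fun_prop) continuous_const
  -- Two points of the same `near` set satisfy |1 - ⟨v, w⟩| < 4(6δ + 6δ) = 48δ. Together with the
  -- radius 7δ used below, this leads to 4(48 + 7) = 220.
  set F : B n → ℝ≥0∞ := fun w => lm {v | ‖1 - herm (v : Cn n) (w : Cn n)‖ < 48 * δ} with hF
  have hFm : Measurable F := measurable_measure_prodMk_left hD.measurableSet
  -- The cutoff costs nothing on the `near` sets, and it keeps w within 6δ of its radial projection
  -- ζ, so a cap of radius δ about ζ lies in the set of radius 7δ about w.
  set H : B n → ℝ≥0∞ :=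
    Set.indicator {w : B n | 1 - ‖(w : Cn n)‖ < 6 * δ} fun w => F w ^ (p - 1) with hH
  have hHset : MeasurableSet {w : B n | 1 - ‖(w : Cn n)‖ < 6 * δ} :=
    (isOpen_lt (by fun_prop) continuous_const).measurableSet
  have hHm : Measurable H := (hFm.pow_const _).indicator hHset
  have hT2 : IsOpen {q : S n × B n | ‖1 - herm (q.1 : Cn n) (q.2 : Cn n)‖ < 7 * δ} := by
    have h1 : Continuous fun q : S n × B n => herm (q.1 : Cn n) (q.2 : Cn n) :=
      continuous_herm_comp (by fun_prop) (by fun_prop)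
    exact isOpen_lt (by fun_prop) continuous_const
  have hz : ∀ ξ : S n, ‖r • (ξ : Cn n)‖ < 1 := fun ξ => by
    rw [norm_smul_sphere ξ hr0]; exact hr1
  have step1 : ∀ ξ : S n, lm (near (r • (ξ : Cn n)) s) ^ p ≤
      ∫⁻ w in {w | (ξ, w) ∈ {q : S n × B n | q.2 ∈ near (r • (q.1 : Cn n)) s}}, H w ∂lm := by
    intro ξ
    have hmeas : MeasurableSet (near (r • (ξ : Cn n)) s) :=
      measurable_prodMk_left (isOpen_near r s).measurableSet
    rw [rpow_eq_rpow_sub_one_mul hp, ← setLIntegral_const]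
    refine setLIntegral_mono' hmeas fun w hw => ?_
    obtain ⟨h1, h2, h3⟩ := near_bounds (hz ξ) hs.le hs' hw
    rw [norm_smul_sphere ξ hr0] at h1 h2 h3
    rw [hH, Set.indicator_of_mem (show w ∈ {w : B n | 1 - ‖(w : Cn n)‖ < 6 * δ} from h3)]
    refine ENNReal.rpow_le_rpow (measure_mono fun v hv => ?_) (by linarith)
    obtain ⟨-, h5, -⟩ := near_bounds (hz ξ) hs.le hs' hv
    rw [norm_smul_sphere ξ hr0] at h5
    have h6 := norm_one_sub_herm_le (norm_coe_ball v).le (norm_coe_ball w).le (hz ξ).le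
    rw [norm_one_sub_herm_comm (v : Cn n) (r • (ξ : Cn n)),
      norm_one_sub_herm_comm (w : Cn n) (r • (ξ : Cn n))] at h6
    change ‖1 - herm (v : Cn n) (w : Cn n)‖ < 48 * δ
    linarith
  have step2 : ∀ w : B n,
      H w * sigma n {ξ | (ξ, w) ∈ {q : S n × B n | q.2 ∈ near (r • (q.1 : Cn n)) s}} ≤
      ENNReal.ofReal (K / c * s ^ (2 * n - 1)) * (H w *
        sigma n {ξ | (ξ, w) ∈ {q : S n × B n | ‖1 - herm (q.1 : Cn n) (q.2 : Cn n)‖ < 7 * δ}}) := by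
    intro w
    by_cases hw : 1 - ‖(w : Cn n)‖ < 6 * δ
    · rw [mul_left_comm]
      gcongr
      -- This is where r ≥ 5/6 enters: 6δ ≤ 1.
      have hw0 : (w : Cn n) ≠ 0 := by
        intro h0
        rw [h0, norm_zero] at hw
        linarith
      obtain ⟨ζ, hζ, hwζ⟩ := exists_unit_smul (w : Cn n) hw0
      calc sigma n {ξ | w ∈ near (r • (ξ : Cn n)) s}
          ≤ ENNReal.ofReal (K * s ^ (2 * n - 1) * δ ^ n) :=
            hup w r s (by linarith) hr1 hs hs'
        _ = ENNReal.ofReal (K / c * s ^ (2 * n - 1)) * ENNReal.ofReal (c * δ ^ n) := by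
            rw [← ENNReal.ofReal_mul (by positivity)]
            congr 1
            field_simp
        _ ≤ ENNReal.ofReal (K / c * s ^ (2 * n - 1)) *
              sigma n {ξ | ‖1 - herm (ξ : Cn n) ζ‖ < δ} := by
            gcongr
            exact hlow ζ δ hζ hδ0 (by linarith)
        _ ≤ _ := by
            gcongr 2
            intro ξ hξ
            have h1 := norm_one_sub_herm_le_add (w : Cn n) ζ (ξ : Cn n)
            have h2 : ‖(w : Cn n) - ζ‖ = 1 - ‖(w : Cn n)‖ := by
              have : (w : Cn n) - ζ = ((‖(w : Cn n)‖ - 1 : ℝ) : ℂ) • ζ := by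
                conv_lhs => rw [hwζ]
                push_cast
                rw [sub_smul, one_smul]
              rw [this, norm_smul, hζ, mul_one, Complex.norm_real, Real.norm_of_nonpos]
              · ring
              · linarith [norm_coe_ball w]
            rw [norm_one_sub_herm_comm ζ, norm_one_sub_herm_comm (w : Cn n), h2,
              norm_coe_sphere] at h1
            have h3 : ‖1 - herm (ξ : Cn n) ζ‖ < δ := hξ
            change ‖1 - herm (ξ : Cn n) (w : Cn n)‖ < 7 * δ
            linarith
    · have : H w = 0 := by
        rw [hH, Set.indicator_of_notMem (show w ∉ {w : B n | 1 - ‖(w : Cn n)‖ < 6 * δ} from hw)]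
      simp [this]
  have step3 : ∀ ξ : S n,
      ∫⁻ w in {w | (ξ, w) ∈ {q : S n × B n | ‖1 - herm (q.1 : Cn n) (q.2 : Cn n)‖ < 7 * δ}},
        H w ∂lm ≤ lm (C ξ (220 * δ)) ^ p := by
    intro ξ
    rw [rpow_eq_rpow_sub_one_mul hp, ← setLIntegral_const]
    have hsub : {w | (ξ, w) ∈ {q : S n × B n | ‖1 - herm (q.1 : Cn n) (q.2 : Cn n)‖ < 7 * δ}} ⊆
        C ξ (220 * δ) := by
      intro w hw
      have h1 : ‖1 - herm (ξ : Cn n) (w : Cn n)‖ < 7 * δ := hw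
      rw [mem_C, norm_one_sub_herm_comm]
      linarith
    refine (setLIntegral_mono' (measurable_prodMk_left hT2.measurableSet) (fun w hw => ?_)).trans
      (lintegral_mono_set hsub)
    have h1 : ‖1 - herm (ξ : Cn n) (w : Cn n)‖ < 7 * δ := hw
    refine (Set.indicator_le_self' (fun _ _ => zero_le) w).trans ?_
    refine ENNReal.rpow_le_rpow (measure_mono fun v hv => ?_) (by linarith)
    have h2 : ‖1 - herm (v : Cn n) (w : Cn n)‖ < 48 * δ := hv
    have h3 := norm_one_sub_herm_le (norm_coe_ball v).le (norm_coe_sphere ξ).le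
      (norm_coe_ball w).le
    rw [mem_C]
    linarith
  calc ∫⁻ ξ : S n, lm (near (r • (ξ : Cn n)) s) ^ p ∂(sigma n)
      ≤ ∫⁻ ξ : S n, ∫⁻ w in {w | (ξ, w) ∈ {q : S n × B n | q.2 ∈ near (r • (q.1 : Cn n)) s}},
          H w ∂lm ∂(sigma n) := lintegral_mono step1
    _ = ∫⁻ w, H w *
          sigma n {ξ | (ξ, w) ∈ {q : S n × B n | q.2 ∈ near (r • (q.1 : Cn n)) s}} ∂lm :=
        lintegral_setLIntegral_swap _ _ (isOpen_near r s).measurableSet hHm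
    _ ≤ ∫⁻ w, ENNReal.ofReal (K / c * s ^ (2 * n - 1)) * (H w * sigma n
          {ξ | (ξ, w) ∈ {q : S n × B n | ‖1 - herm (q.1 : Cn n) (q.2 : Cn n)‖ < 7 * δ}}) ∂lm :=
        lintegral_mono step2
    _ = ENNReal.ofReal (K / c * s ^ (2 * n - 1)) * ∫⁻ ξ : S n, ∫⁻ w in
          {w | (ξ, w) ∈ {q : S n × B n | ‖1 - herm (q.1 : Cn n) (q.2 : Cn n)‖ < 7 * δ}},
            H w ∂lm ∂(sigma n) := by
        rw [lintegral_const_mul' _ _ ENNReal.ofReal_ne_top,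
          lintegral_setLIntegral_swap _ _ hT2.measurableSet hHm]
    _ ≤ _ := by
        gcongr with ξ
        exact step3 ξ

end LocalSets

/-! ### Pointwise bounds for the potential in terms of `lam`. -/

section PotentialBounds

variable {n : ℕ}

theorem measurable_weight :
    Measurable fun w : B n => ENNReal.ofReal ((1 - ‖(w : Cn n)‖) ^ n) := by
  fun_prop

theorem isFiniteMeasure_lam {μ : Measure (B n)}
    (hμ : ∫⁻ w : B n, ENNReal.ofReal ((1 - ‖(w : Cn n)‖ ^ 2) ^ n) ∂μ < ∞) :
    IsFiniteMeasure (lam μ) := by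
  refine isFiniteMeasure_withDensity (ne_top_of_le_ne_top hμ.ne ?_)
  refine lintegral_mono fun w => ENNReal.ofReal_le_ofReal ?_
  have := norm_coe_ball w
  have h0 := norm_nonneg (w : Cn n)
  apply pow_le_pow_left₀ <;> nlinarith

theorem measurableSet_C (ξ : S n) (δ : ℝ) : MeasurableSet (C ξ δ) :=
  measurable_prodMk_left (isOpen_C δ).measurableSet

theorem measurableSet_near (ξ : S n) (r s : ℝ) : MeasurableSet (near (r • (ξ : Cn n)) s) :=
  measurable_prodMk_left (isOpen_near r s).measurableSet

theorem norm_smul_sub_self (ξ : S n) {r : ℝ} (hr : r ≤ 1) :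
    ‖r • (ξ : Cn n) - (ξ : Cn n)‖ = 1 - r := by
  have : r • (ξ : Cn n) - (ξ : Cn n) = (r - 1) • (ξ : Cn n) := by rw [sub_smul, one_smul]
  rw [this, norm_smul, norm_coe_sphere, mul_one, Real.norm_of_nonpos (by linarith)]
  ring

theorem norm_one_sub_herm_smul_le (ξ : S n) (w : B n) {r : ℝ} (hr : r ≤ 1) :
    ‖1 - herm (r • (ξ : Cn n)) (w : Cn n)‖ ≤
      ‖1 - herm (w : Cn n) (ξ : Cn n)‖ + (1 - r) := by
  have h := norm_one_sub_herm_le_add (r • (ξ : Cn n)) (ξ : Cn n) (w : Cn n)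
  rw [norm_smul_sub_self ξ hr, norm_one_sub_herm_comm (ξ : Cn n)] at h
  have := norm_coe_ball w
  nlinarith [norm_nonneg (w : Cn n)]

/-- Moving rξ to ξ costs at most 1 - r, which is already at most |1 - ⟨rξ, w⟩|. -/
theorem norm_one_sub_herm_le_two_mul (ξ : S n) (w : B n) {r : ℝ} (hr0 : 0 ≤ r) (hr : r ≤ 1) :
    ‖1 - herm (w : Cn n) (ξ : Cn n)‖ ≤ 2 * ‖1 - herm (r • (ξ : Cn n)) (w : Cn n)‖ := by
  have h := norm_one_sub_herm_le_add (ξ : Cn n) (r • (ξ : Cn n)) (w : Cn n)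
  rw [norm_sub_rev (ξ : Cn n), norm_smul_sub_self ξ hr, norm_one_sub_herm_comm (ξ : Cn n)] at h
  have h1 := norm_coe_ball w
  have h2 := one_sub_norm_le_left (z := r • (ξ : Cn n)) h1.le
  rw [norm_smul_sphere ξ hr0] at h2
  nlinarith [norm_nonneg (w : Cn n)]

theorem exists_le_potential (hn : 1 < n) :
    ∃ c : ℝ, 0 < c ∧ ∀ (μ : Measure (B n)) (ξ : S n) (r : ℝ), 0 ≤ r → r < 1 →
      ENNReal.ofReal (c * ((1 - r) ^ n)⁻¹) * lam μ (C ξ (1 - r)) ≤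
        potential μ (r • (ξ : Cn n)) := by
  obtain ⟨c, hc, hg⟩ := exists_le_g hn
  refine ⟨c * (1 / 4) ^ n, by positivity, fun μ ξ r hr0 hr => ?_⟩
  have hz : ‖r • (ξ : Cn n)‖ < 1 := by rwa [norm_smul_sphere ξ hr0]
  set δ := 1 - r with hδ
  have hδ0 : 0 < δ := by linarith
  rw [lam, withDensity_apply _ (measurableSet_C ξ δ), ← lintegral_const_mul _ measurable_weight,
    potential]
  refine (setLIntegral_mono' (measurableSet_C ξ δ) (fun w hw => ?_)).trans
    (setLIntegral_le_lintegral (C ξ δ) _)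
  have hw1 := norm_coe_ball w
  refine le_trans ?_ (hg _ (norm_phi_lt_one hz hw1))
  rw [one_sub_norm_phi_sq hz hw1, norm_smul_sphere ξ hr0, ← ENNReal.ofReal_mul (by positivity)]
  apply ENNReal.ofReal_le_ofReal
  rw [mem_C] at hw
  have hm := norm_one_sub_herm_smul_le ξ w hr.le
  have hm0 : 0 < ‖1 - herm (r • (ξ : Cn n)) (w : Cn n)‖ :=
    lt_of_lt_of_le (by linarith) (one_sub_norm_le_left hw1.le)
  set m := ‖1 - herm (r • (ξ : Cn n)) (w : Cn n)‖
  have hw0 := norm_nonneg (w : Cn n)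
  have e : c * (1 / 4) ^ n * (δ ^ n)⁻¹ * (1 - ‖(w : Cn n)‖) ^ n =
      c * ((1 - ‖(w : Cn n)‖) * δ / (2 * δ) ^ 2) ^ n := by
    rw [mul_assoc, mul_assoc, ← inv_pow, ← mul_pow, ← mul_pow]
    congr 2
    field_simp
    norm_num
    ring
  rw [e]
  have h0 : 0 ≤ 1 - ‖(w : Cn n)‖ := by linarith
  have h1 : 1 - ‖(w : Cn n)‖ ≤ 1 - ‖(w : Cn n)‖ ^ 2 := by nlinarith
  have h2 : δ ≤ 1 - r ^ 2 := by nlinarith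
  have h3 : 0 ≤ 1 - ‖(w : Cn n)‖ ^ 2 := by linarith
  have h4 : m ≤ 2 * δ := by linarith
  have h5 : 0 ≤ 1 - r ^ 2 := by linarith
  have h6 : 0 ≤ (1 - ‖(w : Cn n)‖ ^ 2) * (1 - r ^ 2) := mul_nonneg h3 h5
  gcongr

theorem measure_near_le (μ : Measure (B n)) (ξ : S n) {r s : ℝ} (hr0 : 0 ≤ r)
    (hr : r < 1) (hs : 0 ≤ s) (hs' : s ≤ 1 / 2) :
    μ (near (r • (ξ : Cn n)) s) ≤
      ENNReal.ofReal (6 ^ n * ((1 - r) ^ n)⁻¹) * lam μ (near (r • (ξ : Cn n)) s) := by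
  have hz : ‖r • (ξ : Cn n)‖ < 1 := by rwa [norm_smul_sphere ξ hr0]
  have hmeas := measurableSet_near ξ r s
  have hδ : 0 < 1 - r := by linarith
  rw [lam, withDensity_apply _ hmeas, ← lintegral_const_mul _ measurable_weight, ← setLIntegral_one]
  refine setLIntegral_mono' hmeas fun w hw => ?_
  obtain ⟨h1, -, -⟩ := near_bounds hz hs hs' hw
  rw [norm_smul_sphere ξ hr0] at h1
  rw [← ENNReal.ofReal_mul (by positivity), ← ENNReal.ofReal_one]
  apply ENNReal.ofReal_le_ofReal
  rw [← inv_pow, ← mul_pow, ← mul_pow]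
  apply one_le_pow₀
  rw [mul_right_comm, ← div_eq_mul_inv, one_le_div hδ]
  exact h1.le

/-- Dyadic majorant of the Poisson-type kernel. -/
theorem pow_one_sub_norm_phi_sq_le (ξ : S n) (w : B n) {r : ℝ} (hr0 : 0 ≤ r)
    (hr : r < 1) :
    ENNReal.ofReal ((1 - ‖phi (w : Cn n) (r • (ξ : Cn n))‖ ^ 2) ^ n) ≤
      ∑' k : ℕ, ENNReal.ofReal (64 ^ n * ((1 - r) ^ n)⁻¹ * (1 / 4 ^ n) ^ k) *
        (C ξ (2 ^ k * (1 - r))).indicator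
          (fun w => ENNReal.ofReal ((1 - ‖(w : Cn n)‖) ^ n)) w := by
  have hz : ‖r • (ξ : Cn n)‖ < 1 := by rwa [norm_smul_sphere ξ hr0]
  have hw1 := norm_coe_ball w
  have hw0 := norm_nonneg (w : Cn n)
  have hm2 := norm_one_sub_herm_le_two_mul ξ w hr0 hr.le
  have hm := one_sub_norm_le_left (z := r • (ξ : Cn n)) hw1.le
  rw [one_sub_norm_phi_sq hz hw1, norm_smul_sphere ξ hr0]
  rw [norm_smul_sphere ξ hr0] at hm
  set m := ‖1 - herm (r • (ξ : Cn n)) (w : Cn n)‖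
  set x := ‖1 - herm (w : Cn n) (ξ : Cn n)‖ with hx
  set δ := 1 - r with hδ
  have hδ0 : 0 < δ := by linarith
  have hx0 : 0 ≤ x := norm_nonneg _
  -- One index k suffices: w lies in the k-th set, and its kernel is bounded using m ≥ 2^k δ/4. The
  -- factor 64 is 2 · 2 · 4².
  have key : ∃ k : ℕ, x < 2 ^ k * δ ∧ 2 ^ k * δ ≤ 4 * m := by
    by_cases hxδ : x < δ
    · exact ⟨0, by simpa using hxδ, by simp; linarith⟩
    · obtain ⟨k, hk1, hk2⟩ := exists_nat_pow_near (x := x / δ)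
        ((one_le_div hδ0).2 (not_lt.1 hxδ)) (by norm_num : (1 : ℝ) < 2)
      rw [le_div_iff₀ hδ0] at hk1
      rw [div_lt_iff₀ hδ0] at hk2
      refine ⟨k + 1, hk2, ?_⟩
      rw [pow_succ]
      linarith
  obtain ⟨k, hk1, hk2⟩ := key
  refine le_trans ?_ (ENNReal.le_tsum k)
  rw [Set.indicator_of_mem (mem_C.2 hk1), ← ENNReal.ofReal_mul (by positivity)]
  apply ENNReal.ofReal_le_ofReal
  have hm0 : 0 < m := lt_of_lt_of_le hδ0 hm
  have e : 64 ^ n * (δ ^ n)⁻¹ * (1 / 4 ^ n) ^ k * (1 - ‖(w : Cn n)‖) ^ n =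
      ((1 - ‖(w : Cn n)‖) * 2 * (δ * 2) / (2 ^ k * δ / 4) ^ 2) ^ n := by
    rw [one_div, inv_pow, ← pow_mul, mul_comm n k, pow_mul 4 k n, ← inv_pow, ← inv_pow, ← mul_pow,
      ← mul_pow, ← mul_pow]
    congr 1
    rw [show (4 : ℝ) ^ k = (2 ^ k) ^ 2 by rw [← pow_mul, mul_comm, pow_mul]; norm_num]
    field_simp
    norm_num
    ring
  rw [e]
  have h1 : 0 ≤ 1 - ‖(w : Cn n)‖ ^ 2 := by nlinarith
  have h2 : 0 ≤ 1 - r ^ 2 := by nlinarith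
  have h3 : 1 - ‖(w : Cn n)‖ ^ 2 ≤ (1 - ‖(w : Cn n)‖) * 2 := by nlinarith
  have h4 : 1 - r ^ 2 ≤ δ * 2 := by nlinarith
  have h5 : 2 ^ k * δ / 4 ≤ m := by linarith
  have h6 : 0 ≤ 1 - ‖(w : Cn n)‖ := by linarith
  gcongr

theorem exists_potential_le (hn : 1 < n) :
    ∃ K : ℝ, 0 < K ∧ ∀ (μ : Measure (B n)) (ξ : S n) (r : ℝ), 0 ≤ r → r < 1 →
      potential μ (r • (ξ : Cn n)) ≤ ENNReal.ofReal (K * ((1 - r) ^ n)⁻¹) *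
        (∑' k : ℕ, ENNReal.ofReal ((1 / 4 ^ n) ^ k) * lam μ (C ξ (2 ^ k * (1 - r))) +
          ∑' j : ℕ, ENNReal.ofReal (2 ^ (j * (2 * n - 2))) *
            lam μ (near (r • (ξ : Cn n)) ((1 / 2) ^ (j + 1)))) := by
  obtain ⟨K, hK, hg⟩ := exists_g_le hn
  refine ⟨K * 64 ^ n, by positivity, fun μ ξ r hr0 hr => ?_⟩
  have hz : ‖r • (ξ : Cn n)‖ < 1 := by rwa [norm_smul_sphere ξ hr0]
  set z := r • (ξ : Cn n) with hzdef
  have hδ0 : 0 < 1 - r := by linarith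
  have hpt : ∀ w : B n, green z (w : Cn n) ≤ ENNReal.ofReal K *
      (∑' k : ℕ, ENNReal.ofReal (64 ^ n * ((1 - r) ^ n)⁻¹ * (1 / 4 ^ n) ^ k) *
        (C ξ (2 ^ k * (1 - r))).indicator
          (fun w => ENNReal.ofReal ((1 - ‖(w : Cn n)‖) ^ n)) w +
       ∑' j : ℕ, ENNReal.ofReal (2 ^ (j * (2 * n - 2))) *
        (near z ((1 / 2) ^ (j + 1))).indicator (fun _ => 1) w) := by
    intro w
    refine (hg _ (norm_phi_lt_one hz (norm_coe_ball w))).trans ?_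
    gcongr with j
    · exact pow_one_sub_norm_phi_sq_le ξ w hr0 hr
    · split_ifs with h
      · rw [Set.indicator_of_mem ((mem_near_iff hz (by positivity)).2 h), mul_one]
      · exact zero_le
  have hm1 : ∀ k : ℕ, Measurable fun w : B n =>
      ENNReal.ofReal (64 ^ n * ((1 - r) ^ n)⁻¹ * (1 / 4 ^ n) ^ k) *
        (C ξ (2 ^ k * (1 - r))).indicator
          (fun w => ENNReal.ofReal ((1 - ‖(w : Cn n)‖) ^ n)) w := fun k =>
    (measurable_weight.indicator (measurableSet_C _ _)).const_mul _
  have hm2 : ∀ j : ℕ, Measurable fun w : B n => ENNReal.ofReal (2 ^ (j * (2 * n - 2))) *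
        (near z ((1 / 2) ^ (j + 1))).indicator (fun _ => (1 : ℝ≥0∞)) w := fun j =>
    (measurable_const.indicator (measurableSet_near _ _ _)).const_mul _
  calc potential μ z ≤ _ := lintegral_mono hpt
    _ = ENNReal.ofReal K *
      (∑' k : ℕ, ENNReal.ofReal (64 ^ n * ((1 - r) ^ n)⁻¹ * (1 / 4 ^ n) ^ k) *
        lam μ (C ξ (2 ^ k * (1 - r))) +
       ∑' j : ℕ, ENNReal.ofReal (2 ^ (j * (2 * n - 2))) * μ (near z ((1 / 2) ^ (j + 1)))) := by
        rw [lintegral_const_mul' _ _ ENNReal.ofReal_ne_top,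
          lintegral_add_left (Measurable.tsum hm1),
          lintegral_tsum fun k => (hm1 k).aemeasurable,
          lintegral_tsum fun j => (hm2 j).aemeasurable]
        congr 3
        · ext k
          rw [lintegral_const_mul' _ _ ENNReal.ofReal_ne_top,
            lintegral_indicator (measurableSet_C _ _), lam,
            withDensity_apply _ (measurableSet_C _ _)]
        · ext j
          rw [lintegral_const_mul' _ _ ENNReal.ofReal_ne_top,
            lintegral_indicator (measurableSet_near _ _ _), setLIntegral_one]
    _ ≤ ENNReal.ofReal K *
      (∑' k : ℕ, ENNReal.ofReal (64 ^ n * ((1 - r) ^ n)⁻¹) * (ENNReal.ofReal ((1 / 4 ^ n) ^ k) *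
        lam μ (C ξ (2 ^ k * (1 - r)))) +
       ∑' j : ℕ, ENNReal.ofReal (64 ^ n * ((1 - r) ^ n)⁻¹) *
        (ENNReal.ofReal (2 ^ (j * (2 * n - 2))) * lam μ (near z ((1 / 2) ^ (j + 1))))) := by
        refine mul_le_mul' le_rfl (add_le_add (ENNReal.tsum_le_tsum fun k => ?_)
          (ENNReal.tsum_le_tsum fun j => ?_))
        · rw [ENNReal.ofReal_mul (by positivity), mul_assoc]
        · rw [mul_left_comm]
          gcongr
          have hs : ((1 : ℝ) / 2) ^ (j + 1) ≤ 1 / 2 := by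
            rw [pow_succ]
            have : ((1 : ℝ) / 2) ^ j ≤ 1 := pow_le_one₀ (by norm_num) (by norm_num)
            linarith
          refine (measure_near_le μ ξ hr0 hr (by positivity) hs).trans ?_
          gcongr
          norm_num
    _ = _ := by
        rw [ENNReal.tsum_mul_left, ENNReal.tsum_mul_left, ← mul_add, ← mul_assoc,
          ← ENNReal.ofReal_mul hK.le, mul_assoc K]

end PotentialBounds

/-! ### Minkowski's inequality for extended nonnegative functions. -/

section Minkowski

variable {X : Type*} [MeasurableSpace X] {μ : Measure X} {p : ℝ}

theorem lintegral_const_mul_rpow_rpow (hp : 0 < p) (c : ℝ≥0∞) (hc : c ≠ ∞) (f : X → ℝ≥0∞) :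
    (∫⁻ x, (c * f x) ^ p ∂μ) ^ (1 / p) = c * (∫⁻ x, f x ^ p ∂μ) ^ (1 / p) := by
  simp_rw [ENNReal.mul_rpow_of_nonneg _ _ hp.le]
  rw [lintegral_const_mul' _ _ (ENNReal.rpow_ne_top_of_nonneg hp.le hc),
    ENNReal.mul_rpow_of_nonneg _ _ (by positivity), ← ENNReal.rpow_mul, mul_one_div_cancel hp.ne',
    ENNReal.rpow_one]

theorem lintegral_sum_range_rpow_le (hp : 1 ≤ p) {f : ℕ → X → ℝ≥0∞} (hf : ∀ i, Measurable (f i))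
    (N : ℕ) :
    (∫⁻ x, (∑ i ∈ Finset.range N, f i x) ^ p ∂μ) ^ (1 / p) ≤
      ∑ i ∈ Finset.range N, (∫⁻ x, f i x ^ p ∂μ) ^ (1 / p) := by
  have hp0 : 0 < p := by linarith
  induction N with
  | zero => simp [hp0]
  | succ N ih =>
    simp_rw [Finset.sum_range_succ]
    refine (ENNReal.lintegral_Lp_add_le (f := fun x => ∑ i ∈ Finset.range N, f i x)
      (Finset.measurable_sum _ fun i _ => hf i).aemeasurable (hf N).aemeasurable hp).trans ?_
    gcongr

/-- Minkowski's inequality for countable sums. -/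
theorem lintegral_tsum_rpow_le (hp : 1 ≤ p) {f : ℕ → X → ℝ≥0∞} (hf : ∀ i, Measurable (f i)) :
    (∫⁻ x, (∑' i, f i x) ^ p ∂μ) ^ (1 / p) ≤ ∑' i, (∫⁻ x, f i x ^ p ∂μ) ^ (1 / p) := by
  have hp0 : 0 < p := by linarith
  have h := lintegral_tendsto_of_tendsto_of_monotone (μ := μ)
    (f := fun N x => (∑ i ∈ Finset.range N, f i x) ^ p) (F := fun x => (∑' i, f i x) ^ p)
    (fun N => ((Finset.measurable_sum _ fun i _ => hf i).pow_const p).aemeasurable)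
    (ae_of_all _ fun x a b hab => ENNReal.rpow_le_rpow
      (Finset.sum_le_sum_of_subset (Finset.range_mono hab)) hp0.le)
    (ae_of_all _ fun x => (ENNReal.continuous_rpow_const.tendsto _).comp
      ENNReal.summable.hasSum.tendsto_sum_nat)
  refine le_of_tendsto' ((ENNReal.continuous_rpow_const (y := 1 / p)).tendsto _ |>.comp h)
    fun N => ?_
  exact (lintegral_sum_range_rpow_le hp hf N).trans (ENNReal.sum_le_tsum _)

end Minkowski

/-! ### Bounds for the p-th means of the potential. -/

section Means

variable {n : ℕ}

/-- The `p`-th mean over the sphere of the measures of the sets `C(ξ, t)`. -/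
def ballMean (lm : Measure (B n)) (p t : ℝ) : ℝ≥0∞ :=
  (∫⁻ ξ : S n, lm (C ξ t) ^ p ∂(sigma n)) ^ (1 / p)

theorem ballMean_le (hn : 0 < n) {p : ℝ} (hp : 0 < p) (lm : Measure (B n)) (t : ℝ) :
    ballMean lm p t ≤ lm Set.univ := by
  have := isProbabilityMeasure_sigma hn
  calc ballMean lm p t ≤ (∫⁻ _ : S n, lm Set.univ ^ p ∂(sigma n)) ^ (1 / p) := by
        unfold ballMean
        gcongr
        exact Set.subset_univ _
    _ = lm Set.univ := by
        rw [lintegral_const, measure_univ (μ := sigma n), mul_one, ← ENNReal.rpow_mul,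
          mul_one_div_cancel hp.ne', ENNReal.rpow_one]

theorem tsum_ofReal_mul_pow_ne_top {c ρ : ℝ} (hc : 0 ≤ c) (h0 : 0 ≤ ρ) (h1 : ρ < 1) :
    ∑' j : ℕ, ENNReal.ofReal (c * ρ ^ j) ≠ ∞ := by
  rw [← ENNReal.ofReal_tsum_of_nonneg (fun j => by positivity)
    ((summable_geometric_of_lt_one h0 h1).mul_left c)]
  exact ENNReal.ofReal_ne_top

/-- The series that converges exactly because `p < (2n - 1) / (2n - 2)`. -/
theorem tsum_near_coeff_ne_top (hn : 1 < n) {p : ℝ} (hp : 1 < p)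
    (hp' : p < (2 * (n : ℝ) - 1) / (2 * ((n : ℝ) - 1))) {K : ℝ} (hK : 0 < K) :
    ∑' j : ℕ, ENNReal.ofReal (2 ^ (j * (2 * n - 2))) *
      ENNReal.ofReal (K * ((1 / 2) ^ (j + 1)) ^ (2 * n - 1)) ^ (1 / p) ≠ ∞ := by
  have hp0 : 0 < p := by linarith
  have hn1 : (1 : ℝ) < n := by exact_mod_cast hn
  rw [lt_div_iff₀ (by linarith)] at hp'
  set y : ℝ := ((1 / 2 : ℝ) ^ (2 * n - 1)) ^ (1 / p) with hy
  have hy0 : 0 < y := by positivity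
  set ρ : ℝ := 2 ^ (2 * n - 2) * y with hρ
  -- The ratio is 2^((2n-2) - (2n-1)/p), below 1 precisely when p(2n-2) < 2n-1.
  have hρ1 : ρ < 1 := by
    have h1 : y < (1 / 2) ^ (2 * n - 2) := by
      rw [hy, ← Real.rpow_natCast, ← Real.rpow_natCast, ← Real.rpow_mul (by norm_num)]
      apply Real.rpow_lt_rpow_of_exponent_gt (by norm_num) (by norm_num)
      rw [mul_one_div, lt_div_iff₀ hp0, Nat.cast_sub (by omega), Nat.cast_sub (by omega)]
      push_cast
      linarith
    calc ρ < 2 ^ (2 * n - 2) * (1 / 2) ^ (2 * n - 2) := by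
          rw [hρ]; gcongr
      _ = 1 := by rw [← mul_pow]; norm_num
  refine ne_top_of_le_ne_top (tsum_ofReal_mul_pow_ne_top (c := K ^ (1 / p)) (by positivity)
    (by positivity) hρ1) (ENNReal.tsum_le_tsum fun j => ?_)
  rw [ENNReal.ofReal_rpow_of_nonneg (by positivity) (by positivity),
    ← ENNReal.ofReal_mul (by positivity)]
  apply ENNReal.ofReal_le_ofReal
  have h2 : (K * ((1 / 2) ^ (j + 1)) ^ (2 * n - 1)) ^ (1 / p) ≤ K ^ (1 / p) * y ^ j := by
    rw [hy, Real.rpow_pow_comm (by positivity), ← Real.mul_rpow hK.le (by positivity)]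
    gcongr ?_ ^ _
    gcongr
    rw [← pow_mul, ← pow_mul]
    apply pow_le_pow_of_le_one (by norm_num) (by norm_num)
    nlinarith [Nat.zero_le (2 * n - 1)]
  calc _ ≤ 2 ^ (j * (2 * n - 2)) * (K ^ (1 / p) * y ^ j) := by gcongr
    _ = K ^ (1 / p) * ρ ^ j := by
        rw [hρ, mul_pow, ← pow_mul, mul_comm j]
        ring

/-- Minkowski applied to `exists_potential_le`. Every pole term is bounded by a multiple of the same
mean at scale 220(1 - r), so their sum collapses to that mean times a convergent series. -/
theorem exists_mean_potential_le (hn : 1 < n) {p : ℝ} (hp : 1 < p)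
    (hp' : p < (2 * (n : ℝ) - 1) / (2 * ((n : ℝ) - 1))) :
    ∃ K : ℝ, 0 < K ∧ ∀ (μ : Measure (B n)) [IsFiniteMeasure (lam μ)] (r : ℝ),
      5 / 6 ≤ r → r < 1 →
        mean p r (potential μ) ≤ ENNReal.ofReal (K * ((1 - r) ^ n)⁻¹) *
          (∑' k : ℕ, ENNReal.ofReal ((1 / 4 ^ n) ^ k) * ballMean (lam μ) p (2 ^ k * (1 - r)) +
            ballMean (lam μ) p (220 * (1 - r))) := by
  have hp0 : 0 < p := by linarith
  obtain ⟨K₁, hK₁, hpot⟩ := exists_potential_le hn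
  obtain ⟨K₂, hK₂, hnear⟩ := exists_lintegral_near_rpow_le (n := n) (by omega) hp.le
  have hsum := tsum_near_coeff_ne_top hn hp hp' hK₂
  set Q := ∑' j : ℕ, ENNReal.ofReal (2 ^ (j * (2 * n - 2))) *
      ENNReal.ofReal (K₂ * ((1 / 2) ^ (j + 1)) ^ (2 * n - 1)) ^ (1 / p) with hQ
  have hQr := ENNReal.toReal_nonneg (a := Q)
  refine ⟨K₁ * (1 + Q.toReal), by positivity, fun μ _ r hr hr1 => ?_⟩
  have hr0 : 0 ≤ r := by linarith
  have hδ0 : 0 < 1 - r := by linarith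
  have hmC : ∀ k : ℕ, Measurable fun ξ : S n =>
      ENNReal.ofReal ((1 / 4 ^ n) ^ k) * lam μ (C ξ (2 ^ k * (1 - r))) := fun k =>
    (measurable_measure_C _ _).const_mul _
  have hmN : ∀ j : ℕ, Measurable fun ξ : S n => ENNReal.ofReal (2 ^ (j * (2 * n - 2))) *
      lam μ (near (r • (ξ : Cn n)) ((1 / 2) ^ (j + 1))) := fun j =>
    (measurable_measure_near _ _ _).const_mul _
  have hterm : ∀ j : ℕ, (∫⁻ ξ : S n, (ENNReal.ofReal (2 ^ (j * (2 * n - 2))) *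
      lam μ (near (r • (ξ : Cn n)) ((1 / 2) ^ (j + 1)))) ^ p ∂(sigma n)) ^ (1 / p) ≤
      ENNReal.ofReal (2 ^ (j * (2 * n - 2))) *
        ENNReal.ofReal (K₂ * ((1 / 2) ^ (j + 1)) ^ (2 * n - 1)) ^ (1 / p) *
          ballMean (lam μ) p (220 * (1 - r)) := by
    intro j
    rw [lintegral_const_mul_rpow_rpow hp0 _ ENNReal.ofReal_ne_top, mul_assoc]
    gcongr
    have hs : ((1 : ℝ) / 2) ^ (j + 1) ≤ 1 / 2 := by
      rw [pow_succ]
      have : ((1 : ℝ) / 2) ^ j ≤ 1 := pow_le_one₀ (by norm_num) (by norm_num)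
      linarith
    rw [ballMean, ← ENNReal.mul_rpow_of_nonneg _ _ (by positivity)]
    gcongr
    exact hnear (lam μ) r _ hr hr1 (by positivity) hs
  calc mean p r (potential μ)
      ≤ (∫⁻ ξ : S n, (ENNReal.ofReal (K₁ * ((1 - r) ^ n)⁻¹) *
        ((fun ξ : S n => ∑' k : ℕ, ENNReal.ofReal ((1 / 4 ^ n) ^ k) *
            lam μ (C ξ (2 ^ k * (1 - r)))) +
          fun ξ : S n => ∑' j : ℕ, ENNReal.ofReal (2 ^ (j * (2 * n - 2))) *
            lam μ (near (r • (ξ : Cn n)) ((1 / 2) ^ (j + 1)))) ξ) ^ p ∂(sigma n)) ^ (1 / p) := by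
        unfold mean
        gcongr with ξ
        exact hpot μ ξ r hr0 hr1
    _ ≤ ENNReal.ofReal (K₁ * ((1 - r) ^ n)⁻¹) *
        (∑' k : ℕ, ENNReal.ofReal ((1 / 4 ^ n) ^ k) * ballMean (lam μ) p (2 ^ k * (1 - r)) +
          ∑' j : ℕ, ENNReal.ofReal (2 ^ (j * (2 * n - 2))) *
            ENNReal.ofReal (K₂ * ((1 / 2) ^ (j + 1)) ^ (2 * n - 1)) ^ (1 / p) *
              ballMean (lam μ) p (220 * (1 - r))) := by
        rw [lintegral_const_mul_rpow_rpow hp0 _ ENNReal.ofReal_ne_top]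
        gcongr
        refine (ENNReal.lintegral_Lp_add_le (Measurable.tsum hmC).aemeasurable
          (Measurable.tsum hmN).aemeasurable hp.le).trans (add_le_add ?_ ?_)
        · refine (lintegral_tsum_rpow_le hp.le hmC).trans (ENNReal.tsum_le_tsum fun k => ?_)
          rw [lintegral_const_mul_rpow_rpow hp0 _ ENNReal.ofReal_ne_top, ballMean]
        · exact (lintegral_tsum_rpow_le hp.le hmN).trans (ENNReal.tsum_le_tsum hterm)
    _ ≤ ENNReal.ofReal (K₁ * ((1 - r) ^ n)⁻¹) * (ENNReal.ofReal (1 + Q.toReal) *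
        (∑' k : ℕ, ENNReal.ofReal ((1 / 4 ^ n) ^ k) * ballMean (lam μ) p (2 ^ k * (1 - r)) +
          ballMean (lam μ) p (220 * (1 - r)))) := by
        rw [ENNReal.tsum_mul_right, ← hQ, mul_add (ENNReal.ofReal (1 + Q.toReal))]
        have h1 : 1 ≤ ENNReal.ofReal (1 + Q.toReal) := by
          rw [← ENNReal.ofReal_one]
          exact ENNReal.ofReal_le_ofReal (by linarith)
        have h2 : Q ≤ ENNReal.ofReal (1 + Q.toReal) := by
          conv_lhs => rw [← ENNReal.ofReal_toReal hsum]
          exact ENNReal.ofReal_le_ofReal (by linarith)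
        gcongr
        exact le_mul_of_one_le_left zero_le h1
    _ = _ := by
        rw [← mul_assoc, ← ENNReal.ofReal_mul (by positivity)]
        congr 2
        ring

theorem exists_le_mean_potential (hn : 1 < n) {p : ℝ} (hp : 0 < p) :
    ∃ c : ℝ, 0 < c ∧ ∀ (μ : Measure (B n)) (r : ℝ), 0 ≤ r → r < 1 →
      ENNReal.ofReal (c * ((1 - r) ^ n)⁻¹) * ballMean (lam μ) p (1 - r) ≤
        mean p r (potential μ) := by
  obtain ⟨c, hc, h⟩ := exists_le_potential hn
  refine ⟨c, hc, fun μ r hr0 hr => ?_⟩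
  rw [ballMean, ← lintegral_const_mul_rpow_rpow hp _ ENNReal.ofReal_ne_top, mean]
  gcongr with ξ
  exact h μ ξ r hr0 hr

end Means

/-! ### Passage to the limit in the dyadic sum. -/

section Asymptotics

theorem ofReal_mul_div_ofReal_rpow_sub {n : ℕ} {K δ γ : ℝ} (hK : 0 ≤ K) (hδ : 0 < δ) (x : ℝ≥0∞) :
    ENNReal.ofReal (K * (δ ^ n)⁻¹) * x / ENNReal.ofReal (δ ^ (γ - (n : ℝ))) =
      ENNReal.ofReal K * (x / ENNReal.ofReal (δ ^ γ)) := by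
  have hpos : 0 < (δ ^ n)⁻¹ := by positivity
  rw [Real.rpow_sub hδ, Real.rpow_natCast, div_eq_mul_inv (δ ^ γ), ENNReal.ofReal_mul hK,
    ENNReal.ofReal_mul (by positivity), mul_right_comm,
    ENNReal.mul_div_mul_right _ _ (ENNReal.ofReal_pos.2 hpos).ne' ENNReal.ofReal_ne_top,
    mul_div_assoc]

/-- A bounded function that is `o(t^γ)` at zero is `≤ ε t^γ + O(t^γ')` on the half line. -/
theorem exists_le_add_of_tendsto {f : ℝ → ℝ≥0∞} {L : ℝ≥0∞} (hL : L ≠ ∞) (hf : ∀ t, f t ≤ L)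
    {γ γ' : ℝ} (hγ' : 0 ≤ γ')
    (h : Tendsto (fun t => f t / ENNReal.ofReal (t ^ γ)) (𝓝[>] 0) (𝓝 0)) {ε : ℝ≥0∞} (hε : 0 < ε) :
    ∃ M : ℝ, 0 ≤ M ∧ ∀ t, 0 < t →
      f t ≤ ε * ENNReal.ofReal (t ^ γ) + ENNReal.ofReal (M * t ^ γ') := by
  have h1 := ENNReal.tendsto_nhds_zero.1 h ε hε
  obtain ⟨t₀, ht₀, h2⟩ := mem_nhdsGT_iff_exists_Ioo_subset.1 h1
  have ht₀' : 0 < t₀ := ht₀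
  have hL0 := ENNReal.toReal_nonneg (a := L)
  refine ⟨L.toReal * (t₀ ^ γ')⁻¹, by positivity, fun t ht => ?_⟩
  by_cases htt : t < t₀
  · have h3 : f t / ENNReal.ofReal (t ^ γ) ≤ ε := h2 ⟨ht, htt⟩
    rw [ENNReal.div_le_iff (ENNReal.ofReal_pos.2 (by positivity)).ne' ENNReal.ofReal_ne_top] at h3
    exact h3.trans le_self_add
  · refine ((hf t).trans ?_).trans le_add_self
    conv_lhs => rw [← ENNReal.ofReal_toReal hL]
    apply ENNReal.ofReal_le_ofReal
    rw [mul_assoc]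
    apply le_mul_of_one_le_right hL0
    rw [inv_mul_eq_div, one_le_div (by positivity)]
    exact Real.rpow_le_rpow ht₀'.le (not_lt.1 htt) hγ'

/-- The o(t^γ) hypothesis controls f only near 0, while 2^k δ reaches every scale. Boundedness
supplies a global majorant ε t^γ + M t^γ' with γ' > γ; its second term is o(δ^γ) at t = δ, and γ' <
2n keeps the sum over k convergent. -/
theorem tendsto_dyadic_sum_div {n : ℕ} {f : ℝ → ℝ≥0∞} {L : ℝ≥0∞} (hL : L ≠ ∞)
    (hf : ∀ t, f t ≤ L) {γ : ℝ} (hγ : 0 ≤ γ) (hγn : γ < 2 * (n : ℝ)) {A : ℝ} (hA : 1 ≤ A)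
    (h : Tendsto (fun t => f t / ENNReal.ofReal (t ^ γ)) (𝓝[>] 0) (𝓝 0)) :
    Tendsto (fun δ => (∑' k : ℕ, ENNReal.ofReal ((1 / 4 ^ n) ^ k) * f (2 ^ k * δ) + f (A * δ)) /
      ENNReal.ofReal (δ ^ γ)) (𝓝[>] 0) (𝓝 0) := by
  obtain ⟨γ', hγγ', hγ'n⟩ := exists_between hγn
  have hγ'0 : 0 ≤ γ' := hγ.trans hγγ'.le
  set ρ : ℝ := 1 / 4 ^ n * 2 ^ γ' with hρ
  have hρ0 : 0 ≤ ρ := by positivity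
  have hρ1 : ρ < 1 := by
    rw [hρ, one_div_mul_eq_div, div_lt_one (by positivity)]
    calc (2 : ℝ) ^ γ' < 2 ^ (2 * (n : ℝ)) :=
          Real.rpow_lt_rpow_of_exponent_lt (by norm_num) hγ'n
      _ = 4 ^ n := by
          rw [Real.rpow_mul (by norm_num), Real.rpow_natCast]; norm_num
  have hQ := tsum_ofReal_mul_pow_ne_top zero_le_one hρ0 hρ1
  set Q := ∑' k : ℕ, ENNReal.ofReal (1 * ρ ^ k) + ENNReal.ofReal (A ^ γ') with hQdef
  have hQ' : Q ≠ ∞ := ENNReal.add_ne_top.2 ⟨hQ, ENNReal.ofReal_ne_top⟩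
  have hQ0 : Q ≠ 0 := by
    have : 0 < ENNReal.ofReal (A ^ γ') := ENNReal.ofReal_pos.2 (by positivity)
    exact (this.trans_le le_add_self).ne'
  rw [ENNReal.tendsto_nhds_zero]
  intro η hη
  -- The factor 2 accounts for the two terms of the majorant, each at most ε δ^γ before scaling.
  set ε := η / (2 * Q) with hε
  have hε0 : 0 < ε := ENNReal.div_pos hη.ne' (ENNReal.mul_ne_top (by norm_num) hQ')
  obtain ⟨M, hM, hbound⟩ := exists_le_add_of_tendsto hL hf hγ'0 h hε0
  have hlim : Tendsto (fun δ : ℝ => ENNReal.ofReal (M * δ ^ (γ' - γ))) (𝓝[>] 0) (𝓝 0) := by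
    have h1 : Tendsto (fun δ : ℝ => M * δ ^ (γ' - γ)) (𝓝 0) (𝓝 (M * 0 ^ (γ' - γ))) :=
      ((Real.continuous_rpow_const (by linarith)).tendsto 0).const_mul M
    rw [Real.zero_rpow (by linarith), mul_zero] at h1
    have h2 := ENNReal.tendsto_ofReal (h1.mono_left (nhdsWithin_le_nhds (s := Set.Ioi 0)))
    rwa [ENNReal.ofReal_zero] at h2
  filter_upwards [self_mem_nhdsWithin, ENNReal.tendsto_nhds_zero.1 hlim ε hε0] with δ hδ hδε
  have hδ0 : 0 < δ := hδ
  have hscale : ∀ a : ℝ, 1 ≤ a →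
      f (a * δ) ≤ ENNReal.ofReal (a ^ γ') * (2 * ε * ENNReal.ofReal (δ ^ γ)) := by
    intro a ha
    have ha0 : 0 < a := by linarith
    have e1 : δ ^ γ' = δ ^ (γ' - γ) * δ ^ γ := by rw [← Real.rpow_add hδ0, sub_add_cancel]
    calc f (a * δ) ≤ ε * ENNReal.ofReal ((a * δ) ^ γ) + ENNReal.ofReal (M * (a * δ) ^ γ') :=
          hbound _ (by positivity)
      _ = ENNReal.ofReal (a ^ γ) * (ε * ENNReal.ofReal (δ ^ γ)) +
          ENNReal.ofReal (a ^ γ') *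
            (ENNReal.ofReal (M * δ ^ (γ' - γ)) * ENNReal.ofReal (δ ^ γ)) := by
          rw [Real.mul_rpow ha0.le hδ0.le, Real.mul_rpow ha0.le hδ0.le,
            ENNReal.ofReal_mul (by positivity), mul_left_comm, e1,
            ← ENNReal.ofReal_mul (by positivity), ← ENNReal.ofReal_mul (by positivity)]
          congr 2
          ring
      _ ≤ ENNReal.ofReal (a ^ γ') * (ε * ENNReal.ofReal (δ ^ γ)) +
          ENNReal.ofReal (a ^ γ') * (ε * ENNReal.ofReal (δ ^ γ)) := by
          gcongr
      _ = _ := by ring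
  have hterm : ∀ k : ℕ, ENNReal.ofReal ((1 / 4 ^ n) ^ k) * f (2 ^ k * δ) ≤
      ENNReal.ofReal (1 * ρ ^ k) * (2 * ε * ENNReal.ofReal (δ ^ γ)) := by
    intro k
    refine (mul_le_mul' le_rfl (hscale (2 ^ k) (one_le_pow₀ (by norm_num)))).trans (le_of_eq ?_)
    rw [← mul_assoc, ← ENNReal.ofReal_mul (by positivity), hρ, mul_pow, one_mul,
      Real.rpow_pow_comm (by norm_num)]
  rw [ENNReal.div_le_iff (ENNReal.ofReal_pos.2 (by positivity)).ne' ENNReal.ofReal_ne_top]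
  calc _ ≤ ∑' k : ℕ, ENNReal.ofReal (1 * ρ ^ k) * (2 * ε * ENNReal.ofReal (δ ^ γ)) +
        ENNReal.ofReal (A ^ γ') * (2 * ε * ENNReal.ofReal (δ ^ γ)) :=
        add_le_add (ENNReal.tsum_le_tsum hterm) (hscale A hA)
    _ = (2 * Q * ε) * ENNReal.ofReal (δ ^ γ) := by
        rw [ENNReal.tsum_mul_right, ← add_mul, ← hQdef]
        ring
    _ ≤ η * ENNReal.ofReal (δ ^ γ) := by
        gcongr
        exact ENNReal.mul_div_le

theorem tendsto_one_sub_nhdsLT : Tendsto (fun r : ℝ => 1 - r) (𝓝[<] 1) (𝓝[>] 0) := by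
  refine tendsto_nhdsWithin_iff.2 ⟨?_, ?_⟩
  · have : Tendsto (fun r : ℝ => 1 - r) (𝓝 1) (𝓝 (1 - 1)) :=
      (continuous_const.sub continuous_id).tendsto 1
    rw [sub_self] at this
    exact this.mono_left nhdsWithin_le_nhds
  · filter_upwards [self_mem_nhdsWithin] with r hr
    exact sub_pos.2 (show r < 1 from hr)

theorem tendsto_one_sub_nhdsGT : Tendsto (fun r : ℝ => 1 - r) (𝓝[>] 0) (𝓝[<] 1) := by
  refine tendsto_nhdsWithin_iff.2 ⟨?_, ?_⟩
  · have : Tendsto (fun r : ℝ => 1 - r) (𝓝 0) (𝓝 (1 - 0)) :=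
      (continuous_const.sub continuous_id).tendsto 0
    rw [sub_zero] at this
    exact this.mono_left nhdsWithin_le_nhds
  · filter_upwards [self_mem_nhdsWithin] with r hr
    exact sub_lt_self (1 : ℝ) (show 0 < r from hr)

end Asymptotics

end GreenPotential

end

/-! ### The equivalence. -/

theorem theorem2 (n : ℕ) (hn : 1 < n) (p : ℝ) (hp : 1 < p)
    (hp' : p < (2 * (n : ℝ) - 1) / (2 * ((n : ℝ) - 1)))
    (γ : ℝ) (hγ : 0 ≤ γ) (hγ' : γ < 2 * (n : ℝ))
    (μ : Measure (GreenPotential.B n))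
    (hμ : ∫⁻ w : GreenPotential.B n,
      ENNReal.ofReal ((1 - ‖(w : GreenPotential.Cn n)‖ ^ 2) ^ n) ∂μ < ∞) :
    Tendsto
        (fun r : ℝ => GreenPotential.mean p r (GreenPotential.potential μ) /
          ENNReal.ofReal ((1 - r) ^ (γ - (n : ℝ))))
        (𝓝[<] 1) (𝓝 0) ↔
      Tendsto
        (fun δ : ℝ =>
          (∫⁻ ξ : GreenPotential.S n,
            (GreenPotential.lam μ (GreenPotential.C ξ δ)) ^ p
              ∂(GreenPotential.sigma n)) ^ (1 / p) /
          ENNReal.ofReal (δ ^ γ))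
        (𝓝[>] 0) (𝓝 0) := by
  have := GreenPotential.isFiniteMeasure_lam hμ
  have hp0 : 0 < p := by linarith
  constructor
  · intro h
    obtain ⟨c, hc, hle⟩ := GreenPotential.exists_le_mean_potential hn hp0
    have h1 := ENNReal.Tendsto.const_mul (a := ENNReal.ofReal c⁻¹)
      (h.comp GreenPotential.tendsto_one_sub_nhdsGT) (Or.inr ENNReal.ofReal_ne_top)
    rw [mul_zero] at h1
    -- Squeeze with r = 1 - δ: the factor δ^(-n) in the lower bound turns division by δ^(γ-n) into
    -- division by δ^γ.
    refine tendsto_of_tendsto_of_tendsto_of_le_of_le' tendsto_const_nhds h1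
      (Eventually.of_forall fun _ => zero_le) ?_
    filter_upwards [Ioo_mem_nhdsGT (zero_lt_one' ℝ)] with δ hδ
    have h2 := hle μ (1 - δ) (by linarith [hδ.2]) (by linarith [hδ.1])
    simp only [Function.comp_apply]
    rw [sub_sub_cancel] at h2 ⊢
    calc _ = ENNReal.ofReal c⁻¹ * (ENNReal.ofReal c *
          (GreenPotential.ballMean (GreenPotential.lam μ) p δ / ENNReal.ofReal (δ ^ γ))) := by
          rw [← mul_assoc, ← ENNReal.ofReal_mul (by positivity), inv_mul_cancel₀ hc.ne',
            ENNReal.ofReal_one, one_mul, GreenPotential.ballMean]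
      _ ≤ _ := by
          rw [← GreenPotential.ofReal_mul_div_ofReal_rpow_sub (n := n) hc.le hδ.1]
          gcongr
  · intro h
    obtain ⟨K, hK, hle⟩ := GreenPotential.exists_mean_potential_le hn hp hp'
    have h1 := GreenPotential.tendsto_dyadic_sum_div (n := n)
      (measure_ne_top (GreenPotential.lam μ) Set.univ)
      (GreenPotential.ballMean_le (by omega) hp0 (GreenPotential.lam μ)) hγ hγ'
      (by norm_num : (1 : ℝ) ≤ 220) h
    have h2 := ENNReal.Tendsto.const_mul (a := ENNReal.ofReal K)
      (h1.comp GreenPotential.tendsto_one_sub_nhdsLT) (Or.inr ENNReal.ofReal_ne_top)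
    rw [mul_zero] at h2
    refine tendsto_of_tendsto_of_tendsto_of_le_of_le' tendsto_const_nhds h2
      (Eventually.of_forall fun _ => zero_le) ?_
    filter_upwards [Ioo_mem_nhdsLT (by norm_num : (5 / 6 : ℝ) < 1)] with r hr
    simp only [Function.comp_apply]
    rw [← GreenPotential.ofReal_mul_div_ofReal_rpow_sub (n := n) hK.le (sub_pos.2 hr.2)]
    gcongr
    exact hle μ r hr.1.le hr.2
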